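/- Let $L=(L_t)_{t\ge 0}$ be a pure-jump Lévy process in $\mathbb{R}^d$ (càdlàg, $L_0=0$, independent and stationary increments) with generating triplet $(\gamma,0,\nu)$, where $\nu$ is a Lévy measure, i.e. $\nu(\{0\})=0$, $\int(|x|^2\wedge 1)\,\nu(dx)<\infty$, and $$\mathbb{E}e^{iu\cdot L_t}=\exp\Big\{t\Big(i\gamma\cdot u+\int(e^{iu\cdot x}-1-iu\cdot x\mathbf 1_{|x|\le1})\,\nu(dx)\Big)\Big\},\qquad u\in\mathbb{R}^d,\ t\ge 0 .$$ For a process $Y$ with càdlàg paths and $0<\varepsilon<1$, write $\Delta Y_s=Y_s-Y_{s-}$ and let $$Y^\varepsilon_t=\gamma t+\sum_{0<s\le t}\Delta Y_s\mathbf 1_{|\Delta Y_s|>1}+\Big(\sum_{0<s\le t}\Delta Y_s\mathbf 1_{\varepsilon\le|\Delta Y_s|\le1}-t\int_{\varepsilon\le|x|\le1}x\,\nu(dx)\Big)$$ be its truncation at level $\varepsilon$. Fix $T>0$. Let $(L_{\cdot,n})_{n\ge1}$ be independent Lévy processes with the same triplet as $L$, let $L_{T,n}$ be the value at time $T$ of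 the $n$-th one, and let $L^\varepsilon_{T,n}$ be the value at time $T$ of its truncation. Let $\Theta_1=\{\theta\in\mathbb{R}^d:\mathbb{E}e^{\theta\cdot L_1}<\infty\}$, $\kappa(\theta)=\ln\mathbb{E}e^{\theta\cdot L_1}$ and $\kappa_\varepsilon(\theta)=\ln\mathbb{E}e^{\theta\cdot L^\varepsilon_1}$. Let $F:\mathbb{R}^d\to\mathbb{R}$, let $\Sigma$ be a real $d\times d$ matrix, and put $F_1=F^2$, $F_2=\nabla F\cdot\Sigma\nabla F$. Fix $i\in\{1,2\}$; if $i=1$ suppose that $F$ is continuous, and if $i=2$ that $F$ is of class $C^1$. Define $$H_i(\theta,x)=(T\nabla\kappa(\theta)-x)\,F_i(x)\,e^{-\theta\cdot x+T\kappa(\theta)},$$ and let $H_i^\varepsilon$ be given by the same formula with $\kappa_\varepsilon$ in place of $\kappa$. Let $K$ be a compact convex set with $0\in K$ and $K\subset\mathring{\Theta}_1$ (the interior of $\Theta_1$), let $\Pi_K$ be the Euclidean projection onto $K$, and let $(\gamma_n)_{n\ge1}$ be a decreasing sequence of positive real numbers with $\sum_n\gamma_n=\infty$ and $\sum_n\gamma_n^2<\infty$.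 Let $\theta_{i,0}=\theta_{i,\varepsilon,0}\in K$ be deterministic and, for $n\ge 0$, $$\theta_{i,n+1}=\Pi_K\big[\theta_{i,n}-\gamma_{n+1}H_i(\theta_{i,n},L_{T,n+1})\big],\qquad \theta_{i,\varepsilon,n+1}=\Pi_K\big[\theta_{i,\varepsilon,n}-\gamma_{n+1}H_i(\theta_{i,\varepsilon,n},L^\varepsilon_{T,n+1})\big].$$ Then for every $n\in\mathbb{N}$, almost surely, $\theta_{i,\varepsilon,n}\to\theta_{i,n}$ as $\varepsilon\to0$. The same convergence holds if $H_i$ is replaced by $H_i^\varepsilon$ in the recursion for $\theta_{i,\varepsilon,n}$. -/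

import Mathlib

open MeasureTheory ProbabilityTheory Filter Topology Set
open scoped NNReal ENNReal

noncomputable section

namespace LevySA

/-- `ℝ^d` with the Euclidean norm and inner product. -/
abbrev E (d : ℕ) : Type := EuclideanSpace ℝ (Fin d)

/-- `ν` is a Lévy measure on `ℝ^d`: no mass at the origin and `∫ (|x|² ∧ 1) ν(dx) < ∞`. -/
structure IsLevyMeasure {d : ℕ} (ν : Measure (E d)) : Prop where
  zero : ν {0} = 0
  lintegral_lt_top : ∫⁻ x, ENNReal.ofReal (min (‖x‖ ^ 2) 1) ∂ν < ∞

/-- The Lévy exponent of the triplet `(b, 0, ν)`: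
`i b·u + ∫ (e^{i u·x} - 1 - i u·x 1_{|x| ≤ 1}) ν(dx)`. -/
def levyExponent {d : ℕ} (b : E d) (ν : Measure (E d)) (u : E d) : ℂ :=
  Complex.I * ((inner ℝ b u : ℝ) : ℂ) +
    ∫ x, (Complex.exp (Complex.I * ((inner ℝ u x : ℝ) : ℂ)) - 1
      - (if ‖x‖ ≤ 1 then Complex.I * ((inner ℝ u x : ℝ) : ℂ) else 0)) ∂ν

/-- A path indexed by `[0, ∞)` is càdlàg: right-continuous with left limits. -/
def IsCadlag {d : ℕ} (x : ℝ≥0 → E d) : Prop :=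
  ∀ t, ContinuousWithinAt x (Ici t) t ∧ ∃ l, Tendsto x (𝓝[<] t) (𝓝 l)

/-- `L` is a pure-jump Lévy process in `ℝ^d` with generating triplet `(b, 0, ν)`: it starts at `0`,
has independent and stationary increments, càdlàg paths, and the characteristic function of the
Lévy-Khintchine representation. -/
structure IsPureJumpLevy {d : ℕ} {Ω : Type*} [MeasurableSpace Ω] (P : Measure Ω)
    (b : E d) (ν : Measure (E d)) (L : ℝ≥0 → Ω → E d) : Prop where
  measurable : ∀ t, Measurable (L t)
  zero : ∀ᵐ ω ∂P, L 0 ω = 0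
  indep : HasIndepIncrements L P
  stationary : ∀ s h, P.map (fun ω => L (s + h) ω - L s ω) = P.map (L h)
  cadlag : ∀ᵐ ω ∂P, IsCadlag (fun t => L t ω)
  charFun_eq : ∀ (t : ℝ≥0) (u : E d),
    ∫ ω, Complex.exp (Complex.I * ((inner ℝ u (L t ω) : ℝ) : ℂ)) ∂P
      = Complex.exp (((t : ℝ) : ℂ) * levyExponent b ν u)

/-- The jump `Δx_s = x_s - x_{s-}` of a path at time `s`. -/
def jump {d : ℕ} (x : ℝ≥0 → E d) (s : ℝ≥0) : E d :=
  x s - Function.leftLim x s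

/-- The jump-truncated process built path by path from the jumps of `L`:
`L^ε_t = b t + ∑_{0<s≤t} ΔL_s 1_{|ΔL_s|>1}
  + (∑_{0<s≤t} ΔL_s 1_{ε≤|ΔL_s|≤1} - t ∫_{ε≤|x|≤1} x ν(dx))`.
A càdlàg path has only finitely many jumps of size at least `ε` on `(0, t]`, so that both sums
are finite. -/
def truncated {d : ℕ} {Ω : Type*} (b : E d) (ν : Measure (E d)) (L : ℝ≥0 → Ω → E d)
    (ε : ℝ) (t : ℝ≥0) (ω : Ω) : E d :=
  (t : ℝ) • b
    + (∑ᶠ s ∈ {s : ℝ≥0 | 0 < s ∧ s ≤ t ∧ 1 < ‖jump (fun r => L r ω) s‖},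
        jump (fun r => L r ω) s)
    + ((∑ᶠ s ∈ {s : ℝ≥0 | 0 < s ∧ s ≤ t ∧ ε ≤ ‖jump (fun r => L r ω) s‖ ∧
            ‖jump (fun r => L r ω) s‖ ≤ 1},
          jump (fun r => L r ω) s)
      - (t : ℝ) • ∫ x in {x : E d | ε ≤ ‖x‖ ∧ ‖x‖ ≤ 1}, x ∂ν)

/-- The set `Θ₁` of all `θ` with `𝔼[exp(θ·L_t)] < ∞`, a condition which does not depend on the
choice of `t > 0`; here `t = 1`. -/
def expMomentSet {d : ℕ} {Ω : Type*} [MeasurableSpace Ω] (P : Measure Ω)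
    (L : ℝ≥0 → Ω → E d) : Set (E d) :=
  {θ | Integrable (fun ω => Real.exp (inner ℝ θ (L 1 ω))) P}

/-- The cumulant generating function `κ(θ) = ln 𝔼[exp(θ·L_1)]`. -/
def cumulant {d : ℕ} {Ω : Type*} [MeasurableSpace Ω] (P : Measure Ω)
    (L : ℝ≥0 → Ω → E d) (θ : E d) : ℝ :=
  Real.log (∫ ω, Real.exp (inner ℝ θ (L 1 ω)) ∂P)

/-- The two functions `F²` (index `0`) and `∇F · S ∇F` (index `1`). -/
def weight {d : ℕ} (F : E d → ℝ) (S : Matrix (Fin d) (Fin d) ℝ) : Fin 2 → E d → ℝ :=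
  ![fun x => F x ^ 2,
    fun x => inner ℝ (gradient F x) (Matrix.toEuclideanLin S (gradient F x))]

/-- `H(θ, x) = (T ∇κ(θ) - x) f(x) exp(-θ·x + T κ(θ))`. -/
def gradField {d : ℕ} (T : ℝ≥0) (κ : E d → ℝ) (f : E d → ℝ) (θ x : E d) : E d :=
  (f x * Real.exp (-(inner ℝ θ x) + (T : ℝ) * κ θ)) • ((T : ℝ) • gradient κ θ - x)

/-- The Euclidean projection onto `K`: a point of `K` at minimal distance from `x`, which exists
and is unique if `K` is nonempty, compact and convex. -/
def proj {d : ℕ} (K : Set (E d)) (x : E d) : E d :=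
  Classical.epsilon fun y => y ∈ K ∧ ∀ z ∈ K, ‖x - y‖ ≤ ‖x - z‖

/-- The projected stochastic approximation recursion
`θ_{n+1} = Π_K[θ_n - γ_{n+1} H(θ_n, x_{n+1})]` started at `θ₀` and driven by the sequence
`x_1, x_2, …`. The value `gain n` is `γ_{n+1}`, and `x n` is `x_{n+1}`. -/
def iterate {d : ℕ} (K : Set (E d)) (H : E d → E d → E d) (gain : ℕ → ℝ) (θ₀ : E d)
    (x : ℕ → E d) : ℕ → E d
  | 0 => θ₀
  | n + 1 => proj K (iterate K H gain θ₀ x n - gain n • H (iterate K H gain θ₀ x n) (x n))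

end LevySA

end

/-!
Convergence of the projected stochastic approximation recursions driven by jump-truncated Lévy
processes.

For fixed `n` the iterate `θ_n` is obtained from finitely many values `L_{T,1}, …, L_{T,n}` by
applying `H` and the projection, which is `1`-Lipschitz. So the claim follows by induction on `n`
(`tendsto_iterate`) once two things are known: the truncated values `L^ε_T` converge almost surely
to `L_T` as `ε → 0` through all positive reals, and `κ_ε`, `∇κ_ε` converge to `κ`, `∇κ`
continuously on the interior of the set of finite exponential moments, that is along `ε_j → 0` and
`θ_j → θ` at the same time.

The almost sure convergence is the Lévy–Itô decomposition (`IsPureJumpLevy.ae_tendsto_truncated`).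
It rests on the joint characteristic function of `L_T` and sums over its jumps. Along fine
partitions of `[0, T]` the sums of a continuous function `g` vanishing near `0` over the
increments of a càdlàg path converge to the sum of `g` over its jumps
(`IsCadlag.tendsto_sum_increments`), and the increments are independent with the law of `L_{T/n}`.
So the joint characteristic function is a limit of `n`-th powers, and it is determined by the
small-time asymptotics `n 𝔼[h(L_{T/n})] → T ∫ h dν` (`IsPureJumpLevy.tendsto_nat_mul_integral`).
These are obtained by weighting the law of `L_{T/n}` with `1 - exp(-|x|²/2)`. The Fourier
transforms of the weighted measures are Gaussian averages of differences of characteristic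
functions, they converge after multiplication by `n`, and Lévy's continuity theorem applies.

From the joint characteristic function of several truncations
(`IsPureJumpLevy.integral_exp_truncated`) one reads off that `L^ε_T` and the remainder `L_T -
L^ε_T` are independent, that the truncations have independent increments in the level, and that
the remainder is centred with a first absolute moment bounded by a multiple of the root of
`∫_{|x|<ε} |x|² ν(dx)`. Doob's maximal inequality on finite grids of levels, together with
left-continuity of `L^ε_T` in `ε`, then controls all small levels at once.

For the cumulant functions, independence and centredness of the remainder give `𝔼 exp(θ·L^ε_T) ≤ 𝔼
exp(θ·L_T)` by `1 + x ≤ exp x`, and with Fatou's lemma the exponential moments converge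
(`IsPureJumpLevy.tendsto_integral_exp_truncated`). Near a given parameter the integrands and their
gradients are dominated by finitely many exponentials whose integrals converge, so a version of
dominated convergence with varying bounds gives the continuous convergence
(`tendsto_log_integral_exp_and_gradient`).
-/

noncomputable section

namespace LevySA

/-! ### Jumps of càdlàg paths as limits of increments -/

/-- The oscillation of a càdlàg path on `[0, T]` is small along short intervals that contain no
point of some finite set. Every `t` has a neighbourhood on which the path is close to `x t` to the
right of `t` and to its left limit on the left of `t`; a finite subcover gives the finite set and
its Lebesgue number the length. -/
theorem IsCadlag.exists_finset_oscillation {d : ℕ} {x : ℝ≥0 → E d} (hx : IsCadlag x) (T : ℝ≥0)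
    {η : ℝ} (hη : 0 < η) :
    ∃ S : Finset ℝ≥0, ∃ δ > 0, ∀ a b : ℝ≥0, a ≤ b → b ≤ T → dist a b < δ →
      (∀ s ∈ S, ¬ (a < s ∧ s ≤ b)) → ‖x b - x a‖ < η := by
  have hloc : ∀ t : ℝ≥0, ∃ r > 0, ∀ a ∈ Metric.ball t r, ∀ b ∈ Metric.ball t r, a ≤ b →
      ¬ (a < t ∧ t ≤ b) → ‖x b - x a‖ < η := by
    intro t
    obtain ⟨hr, l, hl⟩ := hx t
    rw [ContinuousWithinAt, Metric.tendsto_nhdsWithin_nhds] at hr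
    rw [Metric.tendsto_nhdsWithin_nhds] at hl
    obtain ⟨r₁, hr₁, h₁⟩ := hr (η / 2) (by positivity)
    obtain ⟨r₂, hr₂, h₂⟩ := hl (η / 2) (by positivity)
    refine ⟨min r₁ r₂, by positivity, fun a ha b hb hab hn => ?_⟩
    rw [Metric.mem_ball, lt_min_iff] at ha hb
    rw [← dist_eq_norm]
    by_cases hat : a < t
    · have hbt : b < t := not_le.1 fun h => hn ⟨hat, h⟩
      calc dist (x b) (x a) ≤ dist (x b) l + dist (x a) l := dist_triangle_right _ _ _
        _ < η / 2 + η / 2 := add_lt_add (h₂ hbt hb.2) (h₂ hat ha.2)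
        _ = η := by ring
    · have hat' : t ≤ a := not_lt.1 hat
      calc dist (x b) (x a) ≤ dist (x b) (x t) + dist (x a) (x t) := dist_triangle_right _ _ _
        _ < η / 2 + η / 2 := add_lt_add (h₁ (hat'.trans hab) hb.1) (h₁ hat' ha.1)
        _ = η := by ring
  choose r hr hosc using hloc
  have hcomp : IsCompact (Icc (0 : ℝ≥0) T) := isCompact_Icc
  obtain ⟨S, hS⟩ := hcomp.elim_finite_subcover (fun t => Metric.ball t (r t))
    (fun _ => Metric.isOpen_ball) (fun t _ => mem_iUnion.2 ⟨t, Metric.mem_ball_self (hr t)⟩)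
  obtain ⟨δ, hδ, hleb⟩ := lebesgue_number_lemma_of_metric
    (c := fun s : S => Metric.ball s.1 (r s.1)) hcomp (fun _ => Metric.isOpen_ball) (by simpa [iUnion_subtype] using hS)
  refine ⟨S, δ, hδ, fun a b hab hb hd hn => ?_⟩
  obtain ⟨s, hs⟩ := hleb b ⟨zero_le, hb⟩
  exact hosc s a (hs hd) b (hs (Metric.mem_ball_self hδ)) hab (hn s s.2)

theorem nhdsLT_neBot {s : ℝ≥0} (hs : 0 < s) : (𝓝[<] s).NeBot :=
  nhdsLT_neBot_of_exists_lt ⟨0, hs⟩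

theorem IsCadlag.tendsto_leftLim {d : ℕ} {x : ℝ≥0 → E d} (hx : IsCadlag x) (s : ℝ≥0) :
    Tendsto x (𝓝[<] s) (𝓝 (Function.leftLim x s)) :=
  tendsto_leftLim_of_tendsto (hx s).2

/-- The finite set of `IsCadlag.exists_finset_oscillation` can be taken in `(0, T]`, and then all
jumps of size larger than `η` occur in it. -/
theorem IsCadlag.exists_finset_jump_le {d : ℕ} {x : ℝ≥0 → E d} (hx : IsCadlag x) (T : ℝ≥0)
    {η : ℝ} (hη : 0 < η) :
    ∃ S : Finset ℝ≥0, (∀ s ∈ S, 0 < s ∧ s ≤ T) ∧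
      (∃ δ > 0, ∀ a b : ℝ≥0, a ≤ b → b ≤ T → dist a b < δ →
        (∀ s ∈ S, ¬ (a < s ∧ s ≤ b)) → ‖x b - x a‖ < η) ∧
      ∀ s, 0 < s → s ≤ T → s ∉ S → ‖jump x s‖ ≤ η := by
  classical
  obtain ⟨S, δ, hδ, h⟩ := hx.exists_finset_oscillation T hη
  refine ⟨S.filter fun s => 0 < s ∧ s ≤ T, by simp, ⟨δ, hδ, fun a b hab hb hd hn => ?_⟩, ?_⟩
  · refine h a b hab hb hd fun s hs has => hn s ?_ has
    simp [hs, (zero_le).trans_lt has.1, has.2.trans hb]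
  · intro s hs0 hsT hsS
    have hsS' : s ∉ S := fun h => hsS (by simp [h, hs0, hsT])
    have := nhdsLT_neBot hs0
    have hlim : Tendsto (fun a => ‖x s - x a‖) (𝓝[<] s) (𝓝 ‖jump x s‖) :=
      (tendsto_const_nhds.sub (hx.tendsto_leftLim s)).norm
    refine le_of_tendsto hlim ?_
    have h1 : ∀ᶠ a in 𝓝[<] s, ∀ r ∈ S, ¬ (a < r ∧ r ≤ s) := by
      rw [Filter.eventually_all_finset]
      intro r hr
      rcases lt_trichotomy r s with hrs | rfl | hrs
      · filter_upwards [mem_nhdsWithin_of_mem_nhds (Ioi_mem_nhds hrs)] with a ha hh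
        exact absurd hh.1 (not_lt.2 (le_of_lt ha))
      · exact absurd hr hsS'
      · exact Eventually.of_forall fun a hh => absurd hh.2 (not_le.2 hrs)
    filter_upwards [h1, self_mem_nhdsWithin,
      mem_nhdsWithin_of_mem_nhds (Metric.ball_mem_nhds s hδ)] with a ha has had
    exact (h a s (le_of_lt has) hsT had ha).le

/-- The sum `∑_{0<s≤T} g(Δx_s)` of a function of the jumps of a path. -/
def jumpSum {d : ℕ} {G : Type*} [AddCommMonoid G] (g : E d → G) (x : ℝ≥0 → E d) (T : ℝ≥0) : G :=
  ∑ᶠ s ∈ Ioc 0 T, g (jump x s)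

theorem jumpSum_eq_sum {d : ℕ} {G : Type*} [AddCommMonoid G] {g : E d → G} {x : ℝ≥0 → E d}
    {T : ℝ≥0} {S : Finset ℝ≥0} (hS : ∀ s ∈ S, 0 < s ∧ s ≤ T)
    (h : ∀ s, 0 < s → s ≤ T → s ∉ S → g (jump x s) = 0) :
    jumpSum g x T = ∑ s ∈ S, g (jump x s) := by
  refine finsum_mem_eq_sum_of_inter_support_eq _ ?_
  ext s
  simp only [mem_inter_iff, mem_Ioc, Function.mem_support, Finset.mem_coe]
  constructor
  · rintro ⟨⟨h1, h2⟩, h3⟩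
    exact ⟨by_contra fun hc => h3 (h s h1 h2 hc), h3⟩
  · rintro ⟨h1, h3⟩
    exact ⟨hS s h1, h3⟩

/-- Only finitely many jumps of a càdlàg path on `(0, T]` have norm at least `ε`. -/
theorem IsCadlag.exists_finset_jumpSum {d : ℕ} {x : ℝ≥0 → E d} (hx : IsCadlag x) (T : ℝ≥0)
    {ε : ℝ} (hε : 0 < ε) :
    ∃ S : Finset ℝ≥0, (∀ s ∈ S, 0 < s ∧ s ≤ T) ∧
      (∀ s, 0 < s → s ≤ T → s ∉ S → ‖jump x s‖ < ε) := by
  obtain ⟨S, hS, -, h⟩ := hx.exists_finset_jump_le T (half_pos hε)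
  exact ⟨S, hS, fun s h0 hT hs => (h s h0 hT hs).trans_lt (half_lt_self hε)⟩

/-- The `k`-th point of the partition of `[0, T]` into `n` intervals of equal length. -/
def gridPoint (T : ℝ≥0) (n k : ℕ) : ℝ≥0 := k * T / n

theorem gridPoint_mono (T : ℝ≥0) (n : ℕ) : Monotone (gridPoint T n) := fun a b h => by
  unfold gridPoint; gcongr

theorem gridPoint_succ (T : ℝ≥0) (n k : ℕ) : gridPoint T n (k + 1) = gridPoint T n k + T / n := by
  unfold gridPoint; push_cast; rw [add_mul, one_mul, add_div]

theorem gridPoint_self (T : ℝ≥0) {n : ℕ} (hn : n ≠ 0) : gridPoint T n n = T := by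
  unfold gridPoint; field_simp

/-- The number `k` of the partition interval `(kT/n, (k+1)T/n]` that contains `s`. -/
def gridIndex (T : ℝ≥0) (n : ℕ) (s : ℝ≥0) : ℕ := ⌈s * n / T⌉₊ - 1

theorem gridIndex_spec {T s : ℝ≥0} (hs : 0 < s) (hsT : s ≤ T) {n : ℕ} (hn : n ≠ 0) :
    gridIndex T n s < n ∧ gridPoint T n (gridIndex T n s) < s ∧
      s ≤ gridPoint T n (gridIndex T n s + 1) := by
  have hT : 0 < T := hs.trans_le hsT
  have hn' : (0 : ℝ≥0) < n := by positivity
  have hpos : 0 < s * n / T := by positivity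
  have h1 : 0 < ⌈s * n / T⌉₊ := Nat.ceil_pos.2 hpos
  have h2 : gridIndex T n s + 1 = ⌈s * n / T⌉₊ := by unfold gridIndex; omega
  refine ⟨?_, ?_, ?_⟩
  · have : ⌈s * n / T⌉₊ ≤ n := Nat.ceil_le.2 (by
      rw [div_le_iff₀ hT, mul_comm]; gcongr)
    omega
  · have : (gridIndex T n s : ℝ≥0) < s * n / T := Nat.lt_ceil.1 (by omega)
    unfold gridPoint
    rw [div_lt_iff₀ hn']
    rwa [lt_div_iff₀ hT] at this
  · have : s * n / T ≤ ((gridIndex T n s + 1 : ℕ) : ℝ≥0) := by rw [h2]; exact Nat.le_ceil _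
    unfold gridPoint
    rw [le_div_iff₀ hn']
    rwa [div_le_iff₀ hT] at this

theorem tendsto_mesh (T : ℝ≥0) : Tendsto (fun n : ℕ => T / (n : ℝ≥0)) atTop (𝓝 0) :=
  NNReal.tendsto_coe.1 (by simpa using tendsto_const_div_atTop_nhds_zero_nat (T : ℝ))

theorem tendsto_gridPoint_gridIndex {T s : ℝ≥0} (hs : 0 < s) (hsT : s ≤ T) :
    Tendsto (fun n : ℕ => gridPoint T n (gridIndex T n s)) atTop (𝓝[<] s) := by
  refine tendsto_nhdsWithin_iff.2 ⟨?_, ?_⟩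
  · have h : Tendsto (fun n : ℕ => s - T / (n : ℝ≥0)) atTop (𝓝 s) := by
      simpa using (tendsto_const_nhds (x := s)).sub (tendsto_mesh T)
    refine tendsto_of_tendsto_of_tendsto_of_le_of_le' h tendsto_const_nhds ?_ ?_
    · filter_upwards [eventually_ne_atTop 0] with n hn
      have := (gridIndex_spec hs hsT hn).2.2
      rw [gridPoint_succ] at this
      exact tsub_le_iff_right.2 this
    · filter_upwards [eventually_ne_atTop 0] with n hn
      exact (gridIndex_spec hs hsT hn).2.1.le
  · filter_upwards [eventually_ne_atTop 0] with n hn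
    exact (gridIndex_spec hs hsT hn).2.1

theorem tendsto_gridPoint_gridIndex_succ {T s : ℝ≥0} (hs : 0 < s) (hsT : s ≤ T) :
    Tendsto (fun n : ℕ => gridPoint T n (gridIndex T n s + 1)) atTop (𝓝[≥] s) := by
  refine tendsto_nhdsWithin_iff.2 ⟨?_, ?_⟩
  · have h : Tendsto (fun n : ℕ => s + T / (n : ℝ≥0)) atTop (𝓝 s) := by
      simpa using (tendsto_const_nhds (x := s)).add (tendsto_mesh T)
    refine tendsto_of_tendsto_of_tendsto_of_le_of_le' tendsto_const_nhds h ?_ ?_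
    · filter_upwards [eventually_ne_atTop 0] with n hn
      exact (gridIndex_spec hs hsT hn).2.2
    · filter_upwards [eventually_ne_atTop 0] with n hn
      rw [gridPoint_succ]
      gcongr
      exact (gridIndex_spec hs hsT hn).2.1.le
  · filter_upwards [eventually_ne_atTop 0] with n hn
    exact (gridIndex_spec hs hsT hn).2.2

theorem eq_gridIndex {T s : ℝ≥0} (hs : 0 < s) (hsT : s ≤ T) {n k : ℕ} (hn : n ≠ 0)
    (h1 : gridPoint T n k < s) (h2 : s ≤ gridPoint T n (k + 1)) : k = gridIndex T n s := by
  obtain ⟨-, h3, h4⟩ := gridIndex_spec hs hsT hn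
  have m := gridPoint_mono T n
  have a1 : k < gridIndex T n s + 1 := m.reflect_lt (h1.trans_le h4)
  have a2 : gridIndex T n s < k + 1 := m.reflect_lt (h3.trans_le h2)
  omega

/-- For a càdlàg path, the sums of `g` over the increments along finer and finer partitions of
`[0, T]` converge to the sum of `g` over the jumps, if `g` is continuous and vanishes near `0`. -/
theorem IsCadlag.tendsto_sum_increments {d : ℕ} {x : ℝ≥0 → E d} (hx : IsCadlag x) (T : ℝ≥0)
    {G : Type*} [NormedAddCommGroup G] {g : E d → G} (hg : Continuous g) {ε : ℝ} (hε : 0 < ε)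
    (hg0 : ∀ y, ‖y‖ < ε → g y = 0) :
    Tendsto (fun n : ℕ => ∑ k ∈ Finset.range n,
      g (x (gridPoint T n (k + 1)) - x (gridPoint T n k))) atTop (𝓝 (jumpSum g x T)) := by
  classical
  obtain ⟨S, hS, ⟨δ, hδ, hosc⟩, hj⟩ := hx.exists_finset_jump_le T (half_pos hε)
  rw [jumpSum_eq_sum hS fun s h0 hT hs => hg0 _ ((hj s h0 hT hs).trans_lt (half_lt_self hε))]
  have hlim : Tendsto (fun n : ℕ => ∑ s ∈ S, g (x (gridPoint T n (gridIndex T n s + 1))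
      - x (gridPoint T n (gridIndex T n s)))) atTop (𝓝 (∑ s ∈ S, g (jump x s))) := by
    refine tendsto_finsetSum _ fun s hs => (hg.tendsto _).comp ?_
    obtain ⟨h0, hT⟩ := hS s hs
    exact ((hx s).1.tendsto.comp (tendsto_gridPoint_gridIndex_succ h0 hT)).sub
      ((hx.tendsto_leftLim s).comp (tendsto_gridPoint_gridIndex h0 hT))
  refine hlim.congr' ?_
  have hmesh : ∀ᶠ n : ℕ in atTop, ((T / (n : ℝ≥0) : ℝ≥0) : ℝ) < δ := by
    exact (NNReal.tendsto_coe.2 (tendsto_mesh T)).eventually_lt_const hδ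
  -- distinct jump times eventually lie in distinct partition intervals
  have hinj : ∀ᶠ n : ℕ in atTop, ∀ s ∈ S, ∀ s' ∈ S,
      gridIndex T n s = gridIndex T n s' → s = s' := by
    rw [Filter.eventually_all_finset]
    intro s hs
    rw [Filter.eventually_all_finset]
    intro s' hs'
    by_cases hss : s = s'
    · exact Eventually.of_forall fun _ _ => hss
    · rcases lt_or_gt_of_ne hss with hlt | hlt
      · have := (tendsto_gridPoint_gridIndex (hS s' hs').1 (hS s' hs').2).mono_right
          nhdsWithin_le_nhds
        filter_upwards [this.eventually (lt_mem_nhds hlt), eventually_ne_atTop 0] with n hn hn0 he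
        rw [← he] at hn
        exact absurd hn (not_lt.2 (gridIndex_spec (hS s hs).1 (hS s hs).2 hn0).2.1.le)
      · have := (tendsto_gridPoint_gridIndex (hS s hs).1 (hS s hs).2).mono_right
          nhdsWithin_le_nhds
        filter_upwards [this.eventually (lt_mem_nhds hlt), eventually_ne_atTop 0] with n hn hn0 he
        rw [he] at hn
        exact absurd hn (not_lt.2 (gridIndex_spec (hS s' hs').1 (hS s' hs').2 hn0).2.1.le)
  filter_upwards [hmesh, hinj, eventually_ne_atTop 0] with n hn hin hn0
  rw [← Finset.sum_image (s := S) (g := gridIndex T n)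
    (f := fun k => g (x (gridPoint T n (k + 1)) - x (gridPoint T n k)))
    (fun s hs s' hs' h => hin s hs s' hs' h)]
  refine Finset.sum_subset ?_ ?_
  · intro k hk
    obtain ⟨s, hs, rfl⟩ := Finset.mem_image.1 hk
    exact Finset.mem_range.2 (gridIndex_spec (hS s hs).1 (hS s hs).2 hn0).1
  · intro k hk hkS
    refine hg0 _ ((hosc _ _ (gridPoint_mono T n (Nat.le_succ k)) ?_ ?_ ?_).trans
      (half_lt_self hε))
    · have := gridPoint_mono T n (Nat.succ_le_of_lt (Finset.mem_range.1 hk))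
      rwa [gridPoint_self T hn0] at this
    · rw [gridPoint_succ, NNReal.dist_eq]
      push_cast at hn ⊢
      rw [sub_add_cancel_left, abs_neg, abs_of_nonneg (by positivity)]
      exact hn
    · rintro s hs ⟨h1, h2⟩
      exact hkS (Finset.mem_image.2 ⟨s, hs,
        (eq_gridIndex (hS s hs).1 (hS s hs).2 hn0 h1 h2).symm⟩)

/-! ### Small-time asymptotics of a Lévy process -/

theorem norm_exp_I_mul (y : ℝ) : ‖Complex.exp (Complex.I * (y : ℂ))‖ = 1 := by
  rw [mul_comm]; exact Complex.norm_exp_ofReal_mul_I y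

theorem norm_exp_I_mul_sub_one_sub_le (y : ℝ) :
    ‖Complex.exp (Complex.I * (y : ℂ)) - 1 - Complex.I * (y : ℂ)‖ ≤ 2 * y ^ 2 := by
  have hn : ‖Complex.I * (y : ℂ)‖ = |y| := by simp
  rcases le_or_gt |y| 1 with h | h
  · have := Complex.norm_exp_sub_one_sub_id_le (x := Complex.I * (y : ℂ)) (by rwa [hn])
    rw [hn, sq_abs] at this
    nlinarith [sq_nonneg y]
  · have h1 : ‖Complex.exp (Complex.I * (y : ℂ)) - 1‖ ≤ |y| := Real.norm_exp_I_mul_ofReal_sub_one_le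
    have h2 := norm_sub_le (Complex.exp (Complex.I * (y : ℂ)) - 1) (Complex.I * (y : ℂ))
    rw [hn] at h2
    nlinarith [sq_abs y]

theorem norm_exp_I_mul_sub_one_le_two (y : ℝ) :
    ‖Complex.exp (Complex.I * (y : ℂ)) - 1‖ ≤ 2 := by
  refine (norm_sub_le _ _).trans ?_
  rw [norm_exp_I_mul]; norm_num

theorem norm_exp_sub_one_le_of_re_nonpos {z : ℂ} (hz : z.re ≤ 0) : ‖Complex.exp z - 1‖ ≤ ‖z‖ := by
  have hconv : Convex ℝ {w : ℂ | w.re ≤ 0} := convex_halfSpace_re_le 0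
  have := hconv.norm_image_sub_le_of_norm_hasDerivWithin_le (f := Complex.exp) (f' := Complex.exp)
    (C := 1) (x := 0) (y := z) (fun w _ => (Complex.hasDerivAt_exp w).hasDerivWithinAt)
    (fun w hw => by rw [Complex.norm_exp]; exact Real.exp_le_one_iff.2 hw) (by simp) hz
  simpa using this

/-- The integrand of the Lévy exponent. -/
def levyKernel {d : ℕ} (u x : E d) : ℂ :=
  Complex.exp (Complex.I * ((inner ℝ u x : ℝ) : ℂ)) - 1
    - (if ‖x‖ ≤ 1 then Complex.I * ((inner ℝ u x : ℝ) : ℂ) else 0)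

theorem levyExponent_eq {d : ℕ} (b : E d) (ν : Measure (E d)) (u : E d) :
    levyExponent b ν u = Complex.I * ((inner ℝ b u : ℝ) : ℂ) + ∫ x, levyKernel u x ∂ν := rfl

theorem norm_levyKernel_le {d : ℕ} (u x : E d) :
    ‖levyKernel u x‖ ≤ 2 * (1 + ‖u‖ ^ 2) * min (‖x‖ ^ 2) 1 := by
  unfold levyKernel
  split_ifs with h
  · rw [min_eq_left (by nlinarith [norm_nonneg x])]
    refine (norm_exp_I_mul_sub_one_sub_le _).trans ?_
    have h1 := abs_real_inner_le_norm u x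
    have h2 : (inner ℝ u x : ℝ) ^ 2 ≤ (‖u‖ * ‖x‖) ^ 2 := by
      rw [← sq_abs]; gcongr
    nlinarith [sq_nonneg ‖x‖]
  · rw [min_eq_right (by nlinarith [norm_nonneg x]), sub_zero]
    refine (norm_exp_I_mul_sub_one_le_two _).trans ?_
    nlinarith [sq_nonneg ‖u‖]

theorem measurable_levyKernel {d : ℕ} :
    Measurable (Function.uncurry (levyKernel : E d → E d → ℂ)) := by
  unfold levyKernel Function.uncurry
  refine Measurable.sub (by fun_prop) (Measurable.ite ?_ (by fun_prop) measurable_const)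
  exact measurableSet_le (by fun_prop) measurable_const

theorem _root_.Measurable.levyKernel {d : ℕ} {α : Type*} [MeasurableSpace α] {f g : α → E d}
    (hf : Measurable f) (hg : Measurable g) : Measurable fun a => levyKernel (f a) (g a) := by
  have h := (measurable_levyKernel (d := d)).comp (hf.prodMk hg)
  exact h

namespace IsLevyMeasure

variable {d : ℕ} {ν : Measure (E d)}

theorem integrable_min (hν : IsLevyMeasure ν) : Integrable (fun x : E d => min (‖x‖ ^ 2) 1) ν := by
  refine ⟨by fun_prop, ?_⟩
  rw [hasFiniteIntegral_iff_ofReal (Eventually.of_forall fun x => by positivity)]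
  exact hν.lintegral_lt_top

theorem measure_norm_ge_lt_top (hν : IsLevyMeasure ν) {ε : ℝ} (hε : 0 < ε) :
    ν {x | ε ≤ ‖x‖} < ∞ := by
  have h := hν.integrable_min.measure_ge_lt_top (ε := min (ε ^ 2) 1) (by positivity)
  refine (measure_mono fun x hx => ?_).trans_lt h
  simp only [mem_ofPred_eq] at hx ⊢
  gcongr

theorem sigmaFinite (hν : IsLevyMeasure ν) : SigmaFinite ν := by
  refine ⟨⟨⟨fun n => {x | 1 / ((n : ℝ) + 1) ≤ ‖x‖} ∪ {0}, fun _ => trivial, fun n => ?_, ?_⟩⟩⟩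
  · refine (measure_union_le _ _).trans_lt ?_
    rw [hν.zero, add_zero]
    exact hν.measure_norm_ge_lt_top (by positivity)
  · refine eq_univ_of_forall fun x => ?_
    by_cases hx : x = 0
    · exact mem_iUnion.2 ⟨0, Or.inr hx⟩
    · obtain ⟨n, hn⟩ := exists_nat_one_div_lt (norm_pos_iff.2 hx)
      exact mem_iUnion.2 ⟨n, Or.inl hn.le⟩

theorem integrable_levyKernel (hν : IsLevyMeasure ν) (u : E d) : Integrable (levyKernel u) ν :=
  (hν.integrable_min.const_mul (2 * (1 + ‖u‖ ^ 2))).mono'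
    (measurable_levyKernel.of_uncurry_left).aestronglyMeasurable
    (Eventually.of_forall fun x => norm_levyKernel_le u x)

theorem exists_norm_levyExponent_le (hν : IsLevyMeasure ν) (b : E d) :
    ∃ C, 0 ≤ C ∧ ∀ u, ‖levyExponent b ν u‖ ≤ C * (1 + ‖u‖ ^ 2) := by
  have hM : 0 ≤ ∫ x : E d, min (‖x‖ ^ 2) 1 ∂ν := integral_nonneg fun x => by positivity
  refine ⟨‖b‖ + 2 * ∫ x : E d, min (‖x‖ ^ 2) 1 ∂ν, by positivity, fun u => ?_⟩
  rw [levyExponent_eq]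
  refine (norm_add_le _ _).trans ?_
  have h1 : ‖Complex.I * ((inner ℝ b u : ℝ) : ℂ)‖ ≤ ‖b‖ * (1 + ‖u‖ ^ 2) := by
    simp only [norm_mul, Complex.norm_I, one_mul, Complex.norm_real, Real.norm_eq_abs]
    refine (abs_real_inner_le_norm b u).trans ?_
    gcongr
    nlinarith [sq_nonneg (‖u‖ - 1)]
  have h2 : ‖∫ x, levyKernel u x ∂ν‖ ≤ 2 * (1 + ‖u‖ ^ 2) * ∫ x : E d, min (‖x‖ ^ 2) 1 ∂ν := by
    rw [← integral_const_mul]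
    exact norm_integral_le_of_norm_le (hν.integrable_min.const_mul _)
      (Eventually.of_forall fun x => norm_levyKernel_le u x)
  linarith

end IsLevyMeasure

/-- Measurability of a parametric integral, for which `ν` has to be σ-finite. -/
theorem measurable_levyExponent {d : ℕ} {ν : Measure (E d)} (hν : IsLevyMeasure ν) (b : E d) :
    Measurable (levyExponent b ν) := by
  have := hν.sigmaFinite
  have h : StronglyMeasurable fun u : E d => ∫ x, levyKernel u x ∂ν :=
    StronglyMeasurable.integral_prod_right (measurable_levyKernel.stronglyMeasurable)
  have h2 := h.measurable
  change Measurable fun u => Complex.I * ((inner ℝ b u : ℝ) : ℂ) + ∫ x, levyKernel u x ∂ν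
  fun_prop

/-- The weight `1 - exp(-‖x‖²/2)`, that is `1` minus the characteristic function of the standard
Gaussian measure. It makes a Lévy measure finite. -/
def gaussWeight {d : ℕ} (x : E d) : ℝ≥0 := Real.toNNReal (1 - Real.exp (-‖x‖ ^ 2 / 2))

theorem coe_gaussWeight {d : ℕ} (x : E d) :
    (gaussWeight x : ℝ) = 1 - Real.exp (-‖x‖ ^ 2 / 2) :=
  Real.coe_toNNReal _ (sub_nonneg.2 (Real.exp_le_one_iff.2 (by nlinarith [sq_nonneg ‖x‖])))

theorem gaussWeight_le {d : ℕ} (x : E d) : (gaussWeight x : ℝ) ≤ min (‖x‖ ^ 2) 1 := by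
  rw [coe_gaussWeight, le_min_iff]
  have h1 := Real.add_one_le_exp (-‖x‖ ^ 2 / 2)
  have h2 := Real.exp_pos (-‖x‖ ^ 2 / 2)
  constructor <;> nlinarith [sq_nonneg ‖x‖]

theorem gaussWeight_eq_zero {d : ℕ} {x : E d} (h : gaussWeight x = 0) : x = 0 := by
  have h1 := coe_gaussWeight x
  rw [h, NNReal.coe_zero, eq_comm, sub_eq_zero, eq_comm, Real.exp_eq_one_iff] at h1
  have h2 : ‖x‖ ^ 2 = 0 := by linarith
  simpa using h2

theorem continuous_gaussWeight {d : ℕ} : Continuous (gaussWeight : E d → ℝ≥0) := by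
  unfold gaussWeight; fun_prop

theorem integral_exp_inner_stdGaussian {d : ℕ} (x : E d) :
    ∫ u, Complex.exp (Complex.I * ((inner ℝ u x : ℝ) : ℂ)) ∂(stdGaussian (E d))
      = 1 - ((gaussWeight x : ℝ) : ℂ) := by
  have := charFun_stdGaussian x
  rw [charFun_apply] at this
  rw [coe_gaussWeight]
  push_cast
  rw [sub_sub_cancel, ← this]
  simp_rw [mul_comm Complex.I]

theorem integrable_one_add_norm_sq {d : ℕ} :
    Integrable (fun u : E d => 1 + ‖u‖ ^ 2) (stdGaussian (E d)) :=
  (integrable_const 1).add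
    ((IsGaussian.memLp_two_id (μ := stdGaussian (E d))).integrable_norm_pow (by norm_num))

theorem norm_add_sq_le {d : ℕ} (v u : E d) :
    1 + ‖v + u‖ ^ 2 ≤ 2 * (1 + ‖v‖ ^ 2) * (1 + ‖u‖ ^ 2) := by
  have h := norm_add_le v u
  have h2 : ‖v + u‖ ^ 2 ≤ (‖v‖ + ‖u‖) ^ 2 := by gcongr
  nlinarith [sq_nonneg (‖v‖ - ‖u‖), sq_nonneg (‖v‖ * ‖u‖), sq_nonneg ‖v‖, sq_nonneg ‖u‖]

/-- Averaging `ψ(v) - ψ(v + u)` over a Gaussian `u` gives the Fourier transform of the finite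
measure `gaussWeight · ν`: the drift and the compensator are odd in `u` and cancel. -/
theorem integral_levyExponent_sub {d : ℕ} {ν : Measure (E d)} (hν : IsLevyMeasure ν) (b v : E d) :
    ∫ u, (levyExponent b ν v - levyExponent b ν (v + u)) ∂(stdGaussian (E d))
      = ∫ x, (gaussWeight x) • Complex.exp (Complex.I * ((inner ℝ v x : ℝ) : ℂ)) ∂ν := by
  have := hν.sigmaFinite
  set G := stdGaussian (E d)
  have hidG : Integrable (fun u : E d => u) G :=
    (IsGaussian.memLp_two_id (μ := G)).integrable (by norm_num)
  have hlin : ∀ x : E d, Integrable (fun u : E d => Complex.I * ((inner ℝ x u : ℝ) : ℂ)) G :=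
    fun x => ((hidG.const_inner x).ofReal).const_mul _
  have hlin0 : ∀ x : E d, ∫ u, Complex.I * ((inner ℝ x u : ℝ) : ℂ) ∂G = 0 := fun x => by
    rw [integral_const_mul, integral_complex_ofReal, integral_inner hidG, integral_id_stdGaussian]
    simp
  have hint : Integrable (Function.uncurry fun (u x : E d) => levyKernel v x - levyKernel (v + u) x)
      (G.prod ν) := by
    have hm : Measurable (Function.uncurry fun (u x : E d) =>
        levyKernel v x - levyKernel (v + u) x) := by
      have h1 : Measurable fun p : E d × E d => levyKernel v p.2 :=
        measurable_const.levyKernel measurable_snd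
      have h2 : Measurable fun p : E d × E d => levyKernel (v + p.1) p.2 :=
        (measurable_const.add measurable_fst).levyKernel measurable_snd
      exact h1.sub h2
    have hdom : Integrable (fun p : E d × E d =>
        6 * (1 + ‖v‖ ^ 2) * (1 + ‖p.1‖ ^ 2) * min (‖p.2‖ ^ 2) 1) (G.prod ν) :=
      (integrable_one_add_norm_sq.const_mul (6 * (1 + ‖v‖ ^ 2))).mul_prod hν.integrable_min
    refine hdom.mono' hm.aestronglyMeasurable (Eventually.of_forall fun p => ?_)
    refine (norm_sub_le (levyKernel v p.2) (levyKernel (v + p.1) p.2)).trans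
      ((add_le_add (norm_levyKernel_le _ _) (norm_levyKernel_le _ _)).trans ?_)
    rw [← add_mul]
    refine mul_le_mul_of_nonneg_right ?_ (by positivity)
    have h1 := norm_add_sq_le v p.1
    have h2 : (1 + ‖v‖ ^ 2) ≤ (1 + ‖v‖ ^ 2) * (1 + ‖p.1‖ ^ 2) :=
      le_mul_of_one_le_right (by positivity) (by nlinarith [sq_nonneg ‖p.1‖])
    linarith
  have h1 : ∀ u, levyExponent b ν v - levyExponent b ν (v + u)
      = -(Complex.I * ((inner ℝ b u : ℝ) : ℂ)) + ∫ x, (levyKernel v x - levyKernel (v + u) x) ∂ν := by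
    intro u
    rw [integral_sub (hν.integrable_levyKernel _) (hν.integrable_levyKernel _), levyExponent_eq,
      levyExponent_eq, inner_add_right]
    push_cast; ring
  simp_rw [h1]
  have hA : Integrable (fun u : E d => -(Complex.I * ((inner ℝ b u : ℝ) : ℂ))) G := (hlin b).neg
  have hB : Integrable (fun u => ∫ x, (levyKernel v x - levyKernel (v + u) x) ∂ν) G :=
    hint.integral_prod_left
  rw [integral_add hA hB, integral_neg, hlin0, neg_zero, zero_add,
    integral_integral_swap hint]
  refine integral_congr_ae (Eventually.of_forall fun x => ?_)
  have h2 : ∀ u, levyKernel v x - levyKernel (v + u) x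
      = Complex.exp (Complex.I * ((inner ℝ v x : ℝ) : ℂ))
        - Complex.exp (Complex.I * ((inner ℝ v x : ℝ) : ℂ))
          * Complex.exp (Complex.I * ((inner ℝ u x : ℝ) : ℂ))
        + (if ‖x‖ ≤ 1 then 1 else 0) * (Complex.I * ((inner ℝ x u : ℝ) : ℂ)) := by
    intro u
    unfold levyKernel
    rw [← Complex.exp_add, inner_add_left, real_inner_comm x u]
    split_ifs <;> push_cast <;> ring_nf
  have hexp : Integrable (fun u : E d => Complex.exp (Complex.I * ((inner ℝ u x : ℝ) : ℂ))) G :=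
    Integrable.of_bound (by fun_prop) 1 (Eventually.of_forall fun u => (norm_exp_I_mul _).le)
  simp only [h2]
  have hD : Integrable (fun u : E d => Complex.exp (Complex.I * ((inner ℝ v x : ℝ) : ℂ))
        - Complex.exp (Complex.I * ((inner ℝ v x : ℝ) : ℂ))
          * Complex.exp (Complex.I * ((inner ℝ u x : ℝ) : ℂ))) G :=
    (integrable_const _).sub (hexp.const_mul _)
  rw [integral_add hD ((hlin x).const_mul _),
    integral_sub (integrable_const _) (hexp.const_mul _), integral_const_mul, integral_const_mul,
    hlin0, integral_exp_inner_stdGaussian, NNReal.smul_def, Complex.real_smul]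
  simp
  ring

/-- The counterpart of `integral_levyExponent_sub` for a probability measure, with its
characteristic function in place of the Lévy exponent. -/
theorem integral_gaussWeight_smul_exp {d : ℕ} (μ : Measure (E d)) [IsProbabilityMeasure μ]
    (v : E d) :
    ∫ x, (gaussWeight x) • Complex.exp (Complex.I * ((inner ℝ v x : ℝ) : ℂ)) ∂μ
      = ∫ u, ((∫ x, Complex.exp (Complex.I * ((inner ℝ v x : ℝ) : ℂ)) ∂μ)
        - ∫ x, Complex.exp (Complex.I * ((inner ℝ (v + u) x : ℝ) : ℂ)) ∂μ) ∂(stdGaussian (E d)) := by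
  set G := stdGaussian (E d)
  have hexp : ∀ v : E d, Integrable
      (fun x : E d => Complex.exp (Complex.I * ((inner ℝ v x : ℝ) : ℂ))) μ := fun v =>
    Integrable.of_bound (by fun_prop) 1 (Eventually.of_forall fun u => (norm_exp_I_mul _).le)
  have hint : Integrable (Function.uncurry fun (u x : E d) =>
      Complex.exp (Complex.I * ((inner ℝ v x : ℝ) : ℂ))
        - Complex.exp (Complex.I * ((inner ℝ (v + u) x : ℝ) : ℂ))) (G.prod μ) := by
    refine Integrable.of_bound (by unfold Function.uncurry; fun_prop) 2
      (Eventually.of_forall fun p => ?_)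
    refine (norm_sub_le _ _).trans ?_
    rw [norm_exp_I_mul, norm_exp_I_mul]; norm_num
  simp_rw [← fun u => integral_sub (hexp v) (hexp (v + u))]
  rw [integral_integral_swap hint]
  refine integral_congr_ae (Eventually.of_forall fun x => ?_)
  have h2 : ∀ u : E d, Complex.exp (Complex.I * ((inner ℝ (v + u) x : ℝ) : ℂ))
      = Complex.exp (Complex.I * ((inner ℝ v x : ℝ) : ℂ))
          * Complex.exp (Complex.I * ((inner ℝ u x : ℝ) : ℂ)) := by
    intro u
    rw [← Complex.exp_add, inner_add_left]
    push_cast; ring_nf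
  have hexpG : Integrable (fun u : E d => Complex.exp (Complex.I * ((inner ℝ u x : ℝ) : ℂ))) G :=
    Integrable.of_bound (by fun_prop) 1 (Eventually.of_forall fun u => (norm_exp_I_mul _).le)
  simp only [h2]
  rw [integral_sub (integrable_const _) (hexpG.const_mul _), integral_const_mul,
    integral_exp_inner_stdGaussian, NNReal.smul_def, Complex.real_smul]
  simp
  ring

/-- Lévy's continuity theorem for finite measures. -/
theorem tendsto_integral_of_tendsto_charFun {d : ℕ} {ρ : ℕ → Measure (E d)} {ρ' : Measure (E d)}
    [∀ n, IsFiniteMeasure (ρ n)] [IsFiniteMeasure ρ']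
    (h : ∀ v, Tendsto (fun n => charFun (ρ n) v) atTop (𝓝 (charFun ρ' v)))
    (f : BoundedContinuousFunction (E d) ℂ) :
    Tendsto (fun n => ∫ x, f x ∂(ρ n)) atTop (𝓝 (∫ x, f x ∂ρ')) := by
  -- The unit mass at the origin keeps the total masses away from `0`, also if `ρ' = 0`.
  let σ : Measure (E d) → Measure (E d) := fun m => (m + Measure.dirac 0)
  let c : Measure (E d) → ℝ≥0∞ := fun m => (σ m univ)
  have hc0 : ∀ m, c m ≠ 0 := fun m => by simp [c, σ]
  have hct : ∀ m [IsFiniteMeasure m], c m ≠ ∞ := fun m _ => by simp [c, σ]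
  have hprob : ∀ m [IsFiniteMeasure m], IsProbabilityMeasure ((c m)⁻¹ • σ m) := fun m _ =>
    ⟨by rw [Measure.smul_apply, smul_eq_mul]; exact ENNReal.inv_mul_cancel (hc0 m) (hct m)⟩
  have hint : ∀ m [IsFiniteMeasure m] (g : E d → ℂ), Continuous g → (∃ C, ∀ x, ‖g x‖ ≤ C) →
      ∫ x, g x ∂((c m)⁻¹ • σ m) = ((c m).toReal : ℂ)⁻¹ * ((∫ x, g x ∂m) + g 0) := by
    intro m _ g hg ⟨C, hC⟩
    have hi : ∀ m [IsFiniteMeasure m], Integrable g m := fun m _ =>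
      Integrable.of_bound hg.aestronglyMeasurable C (Eventually.of_forall hC)
    rw [integral_smul_measure, integral_add_measure (hi _) (hi _), integral_dirac,
      ENNReal.toReal_inv, Complex.real_smul]
    push_cast; rfl
  have hchar : ∀ m [IsFiniteMeasure m] (v : E d),
      charFun ((c m)⁻¹ • σ m) v = ((c m).toReal : ℂ)⁻¹ * (charFun m v + 1) := by
    intro m _ v
    rw [charFun_apply, charFun_apply,
      hint m _ (by fun_prop) ⟨1, fun x => (Complex.norm_exp_ofReal_mul_I _).le⟩]
    simp
  have hcm : ∀ m [IsFiniteMeasure m], ((c m).toReal : ℂ) = charFun m 0 + 1 := by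
    intro m _
    rw [charFun_zero]
    simp only [c, σ, Measure.add_apply, measure_univ]
    rw [ENNReal.toReal_add (measure_ne_top _ _) (by simp)]
    simp [Measure.real]
  have hcne : ∀ m [IsFiniteMeasure m], ((c m).toReal : ℂ) ≠ 0 := fun m _ => by
    exact_mod_cast (ENNReal.toReal_pos (hc0 m) (hct m)).ne'
  have hclim : Tendsto (fun n => ((c (ρ n)).toReal : ℂ)) atTop (𝓝 ((c ρ').toReal : ℂ)) := by
    simp_rw [hcm]
    exact (h 0).add_const 1
  have key := (ProbabilityMeasure.tendsto_iff_tendsto_charFun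
    (μ := fun n => (⟨_, hprob (ρ n)⟩ : ProbabilityMeasure (E d))) (μ₀ := ⟨_, hprob ρ'⟩)).2 (by
      intro v
      simp only [ProbabilityMeasure.coe_mk]
      simp_rw [hchar]
      exact (hclim.inv₀ (hcne _)).mul ((h v).add_const 1))
  have key2 := (ProbabilityMeasure.tendsto_iff_forall_integral_rclike_tendsto ℂ).1 key f
  simp only [ProbabilityMeasure.coe_mk] at key2
  have hf := fun m [IsFiniteMeasure m] => hint m f f.continuous ⟨‖f‖, f.norm_coe_le_norm⟩
  simp_rw [hf] at key2
  have := (hclim.mul key2).sub_const (f 0)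
  simpa [mul_inv_cancel_left₀ (hcne _)] using this

theorem tendsto_nat_mul_exp_sub_one (z : ℂ) :
    Tendsto (fun n : ℕ => (n : ℂ) * (Complex.exp (z / n) - 1)) atTop (𝓝 z) := by
  have h := (Complex.hasDerivAt_exp 0)
  have h2 : HasDerivAt (fun t : ℂ => Complex.exp (t * z)) z 0 := by
    simpa using (((hasDerivAt_id (0 : ℂ)).mul_const z).cexp)
  have h3 := h2.tendsto_slope_zero
  have h4 : Tendsto (fun n : ℕ => ((n : ℂ))⁻¹) atTop (𝓝[≠] 0) := by
    refine tendsto_nhdsWithin_iff.2 ⟨tendsto_inv_atTop_nhds_zero_nat (𝕜 := ℂ), ?_⟩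
    filter_upwards [eventually_ne_atTop 0] with n hn
    simpa using hn
  refine (h3.comp h4).congr fun n => ?_
  simp [div_eq_inv_mul]

namespace IsPureJumpLevy

variable {d : ℕ} {Ω : Type*} [MeasurableSpace Ω] {P : Measure Ω}
  {b : E d} {ν : Measure (E d)} {L : ℝ≥0 → Ω → E d}

theorem re_levyExponent_nonpos [IsProbabilityMeasure P] (hL : IsPureJumpLevy P b ν L) (u : E d) :
    (levyExponent b ν u).re ≤ 0 := by
  have h := hL.charFun_eq 1 u
  have h1 : ‖∫ ω, Complex.exp (Complex.I * ((inner ℝ u (L 1 ω) : ℝ) : ℂ)) ∂P‖ ≤ 1 := by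
    refine (norm_integral_le_of_norm_le (integrable_const (1 : ℝ))
      (Eventually.of_forall fun ω => (norm_exp_I_mul _).le)).trans ?_
    simp
  rw [h, Complex.norm_exp] at h1
  simpa using h1

theorem integral_map_exp (hL : IsPureJumpLevy P b ν L) (t : ℝ≥0) (u : E d) :
    ∫ x, Complex.exp (Complex.I * ((inner ℝ u x : ℝ) : ℂ)) ∂(P.map (L t))
      = Complex.exp (((t : ℝ) : ℂ) * levyExponent b ν u) := by
  rw [integral_map (hL.measurable t).aemeasurable (by fun_prop), hL.charFun_eq]

/-- The small-time asymptotics of a Lévy process: `n 𝔼[h(L_{T/n})] → T ∫ h dν` for bounded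
continuous `h` vanishing near the origin. -/
theorem tendsto_nat_mul_integral [IsProbabilityMeasure P] (hL : IsPureJumpLevy P b ν L)
    (hν : IsLevyMeasure ν) (T : ℝ≥0)
    {h : E d → ℂ} (hc : Continuous h) {C : ℝ} (hC : ∀ x, ‖h x‖ ≤ C) {ε : ℝ} (hε : 0 < ε)
    (h0 : ∀ x, ‖x‖ < ε → h x = 0) :
    Tendsto (fun n : ℕ => (n : ℂ) * ∫ ω, h (L (T / n) ω) ∂P) atTop
      (𝓝 (((T : ℝ) : ℂ) * ∫ x, h x ∂ν)) := by
  have := hν.sigmaFinite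
  set μ : ℕ → Measure (E d) := fun n => P.map (L (T / n)) with hμ
  have hprob : ∀ n, IsProbabilityMeasure (μ n) := fun n =>
    Measure.isProbabilityMeasure_map (hL.measurable _).aemeasurable
  let w : Measure (E d) → Measure (E d) := fun m => m.withDensity fun x => (gaussWeight x : ℝ≥0∞)
  have hw : ∀ m, Integrable (fun x : E d => min (‖x‖ ^ 2) 1) m → IsFiniteMeasure (w m) := by
    intro m hm
    refine isFiniteMeasure_withDensity ?_
    refine ne_of_lt (lt_of_le_of_lt (lintegral_mono fun x => ?_) hm.lintegral_lt_top)
    rw [← ENNReal.ofReal_coe_nnreal]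
    exact ENNReal.ofReal_le_ofReal (gaussWeight_le x)
  have hwμ : ∀ n, IsFiniteMeasure (w (μ n)) := fun n => hw _ <| by
    refine Integrable.of_bound (by fun_prop) 1 (Eventually.of_forall fun x => ?_)
    rw [Real.norm_of_nonneg (by positivity)]
    exact min_le_right _ _
  have hwν : IsFiniteMeasure (w ν) := hw _ hν.integrable_min
  have hintw : ∀ (m : Measure (E d)) (g : E d → ℂ), ∫ x, g x ∂(w m)
      = ∫ x, gaussWeight x • g x ∂m := fun m g =>
    integral_withDensity_eq_integral_smul continuous_gaussWeight.measurable g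
  have hcharw : ∀ (m : Measure (E d)) v, charFun (w m) v
      = ∫ x, gaussWeight x • Complex.exp (Complex.I * ((inner ℝ v x : ℝ) : ℂ)) ∂m := fun m v => by
    rw [charFun_apply, hintw]
    simp_rw [real_inner_comm v, mul_comm Complex.I]
  -- the quotient `h / gaussWeight` is a bounded continuous function
  have hwpos : ∀ x : E d, x ≠ 0 → (gaussWeight x : ℂ) ≠ 0 := fun x hx hz =>
    hx (gaussWeight_eq_zero (by exact_mod_cast hz))
  have hquot : Continuous fun x => h x / ((gaussWeight x : ℝ) : ℂ) := by
    refine continuous_iff_continuousAt.2 fun x => ?_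
    by_cases hx : x = 0
    · subst hx
      have : (fun x => h x / ((gaussWeight x : ℝ) : ℂ)) =ᶠ[𝓝 0] fun _ => 0 := by
        filter_upwards [Metric.ball_mem_nhds (0 : E d) hε] with y hy
        rw [h0 y (by simpa using hy), zero_div]
      exact continuousAt_const.congr this.symm
    · refine hc.continuousAt.div ?_ (hwpos x hx)
      exact (Complex.continuous_ofReal.comp
        (NNReal.continuous_coe.comp continuous_gaussWeight)).continuousAt
  have hC0 : 0 ≤ C := (norm_nonneg _).trans (hC 0)
  have hbd : ∀ x, ‖h x / ((gaussWeight x : ℝ) : ℂ)‖ ≤ C / (1 - Real.exp (-ε ^ 2 / 2)) := by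
    have hpos : 0 < 1 - Real.exp (-ε ^ 2 / 2) :=
      sub_pos.2 (Real.exp_lt_one_iff.2 (by nlinarith [sq_pos_of_pos hε]))
    intro x
    rcases lt_or_ge ‖x‖ ε with hx | hx
    · rw [h0 x hx, zero_div, norm_zero]; positivity
    · rw [norm_div, Complex.norm_real, Real.norm_of_nonneg (NNReal.coe_nonneg _), coe_gaussWeight]
      have : ε ^ 2 ≤ ‖x‖ ^ 2 := by gcongr
      gcongr
      exact hC x
  let f : BoundedContinuousFunction (E d) ℂ :=
    BoundedContinuousFunction.ofNormedAddCommGroup _ hquot _ hbd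
  have hf : ∀ x, gaussWeight x • f x = h x := by
    intro x
    change gaussWeight x • (h x / ((gaussWeight x : ℝ) : ℂ)) = h x
    rw [NNReal.smul_def, Complex.real_smul]
    by_cases hx : x = 0
    · rw [hx, h0 0 (by simpa using hε)]; simp
    · exact mul_div_cancel₀ _ (hwpos x hx)
  -- the measures `n · gaussWeight · μ n` converge weakly to `T · gaussWeight · ν`
  have hconv : ∀ v, Tendsto (fun n : ℕ => charFun ((n : ℝ≥0) • w (μ n)) v) atTop
      (𝓝 (charFun (T • w ν) v)) := by
    intro v
    have e1 : ∀ (r : ℝ≥0) (m : Measure (E d)), charFun (r • w m) v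
        = ((r : ℝ) : ℂ) * charFun (w m) v := fun r m => by
      rw [charFun_apply, charFun_apply, integral_smul_nnreal_measure, NNReal.smul_def,
        Complex.real_smul]
    simp_rw [e1, hcharw]
    rw [← integral_levyExponent_sub hν b v, ← integral_const_mul]
    -- both sides are now Gaussian averages, compared by dominated convergence
    simp_rw [integral_gaussWeight_smul_exp, hμ, hL.integral_map_exp, ← integral_const_mul]
    obtain ⟨K, hK0, hK⟩ := hν.exists_norm_levyExponent_le b
    have hbound : ∀ (n : ℕ) (u : E d), ‖(((n : ℝ≥0) : ℝ) : ℂ) *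
        (Complex.exp ((((T / n : ℝ≥0) : ℝ) : ℂ) * levyExponent b ν u) - 1)‖
          ≤ T * (K * (1 + ‖u‖ ^ 2)) := by
      intro n u
      rcases eq_or_ne n 0 with rfl | hn
      · simp; positivity
      · rw [norm_mul]
        have hre : ((((T / n : ℝ≥0) : ℝ) : ℂ) * levyExponent b ν u).re ≤ 0 := by
          rw [Complex.re_ofReal_mul]
          exact mul_nonpos_of_nonneg_of_nonpos (by positivity) (hL.re_levyExponent_nonpos u)
        refine (mul_le_mul_of_nonneg_left (norm_exp_sub_one_le_of_re_nonpos hre)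
          (norm_nonneg _)).trans ?_
        rw [norm_mul, ← mul_assoc]
        have : ‖(((n : ℝ≥0) : ℝ) : ℂ)‖ * ‖(((T / n : ℝ≥0) : ℝ) : ℂ)‖ = T := by
          simp
          field_simp
        rw [this]
        gcongr
        exact hK u
    have hlim : ∀ u, Tendsto (fun n : ℕ => (((n : ℝ≥0) : ℝ) : ℂ) *
        (Complex.exp ((((T / n : ℝ≥0) : ℝ) : ℂ) * levyExponent b ν u) - 1)) atTop
          (𝓝 (((T : ℝ) : ℂ) * levyExponent b ν u)) := by
      intro u
      refine (tendsto_nat_mul_exp_sub_one (((T : ℝ) : ℂ) * levyExponent b ν u)).congr fun n => ?_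
      push_cast
      rw [mul_div_right_comm]
    refine tendsto_integral_of_dominated_convergence
      (fun u => T * (K * (1 + ‖v‖ ^ 2)) + T * (K * (2 * (1 + ‖v‖ ^ 2) * (1 + ‖u‖ ^ 2))))
      (fun n => ?_) ?_ (fun n => Eventually.of_forall fun u => ?_)
      (Eventually.of_forall fun u => ?_)
    · have hm := measurable_levyExponent hν b
      have hm2 : Measurable fun u => levyExponent b ν (v + u) :=
        hm.comp (measurable_const.add measurable_id)
      exact Measurable.aestronglyMeasurable (by fun_prop)
    · exact (integrable_const _).add (((integrable_one_add_norm_sq.const_mul _).const_mul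
        _).const_mul _)
    · have e : ∀ a x y : ℂ, a * (x - y) = a * (x - 1) - a * (y - 1) := fun a x y => by ring
      rw [e]
      refine (norm_sub_le _ _).trans (add_le_add (hbound n v) ((hbound n _).trans ?_))
      have := norm_add_sq_le v u
      gcongr
    · have e : ∀ a x y : ℂ, a * (x - y) = a * (x - 1) - a * (y - 1) := fun a x y => by ring
      rw [mul_sub ((T : ℝ) : ℂ)]
      exact ((hlim v).sub (hlim (v + u))).congr fun n => (e _ _ _).symm
  have key := tendsto_integral_of_tendsto_charFun hconv f
  simp_rw [integral_smul_nnreal_measure, hintw, hf, NNReal.smul_def, Complex.real_smul] at key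
  refine key.congr fun n => ?_
  rw [hμ, integral_map (hL.measurable _).aemeasurable hc.aestronglyMeasurable]
  simp

end IsPureJumpLevy

/-! ### Joint characteristic function of a Lévy process and its jumps -/

namespace IsPureJumpLevy

variable {d : ℕ} {Ω : Type*} [MeasurableSpace Ω] {P : Measure Ω}
  {b : E d} {ν : Measure (E d)} {L : ℝ≥0 → Ω → E d}

theorem integral_comp_increment (hL : IsPureJumpLevy P b ν L) (s h : ℝ≥0) {f : E d → ℂ}
    (hf : Continuous f) : ∫ ω, f (L (s + h) ω - L s ω) ∂P = ∫ ω, f (L h ω) ∂P := by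
  rw [← integral_map (φ := fun ω => L (s + h) ω - L s ω)
      ((hL.measurable _).sub (hL.measurable _)).aemeasurable hf.aestronglyMeasurable,
    hL.stationary, integral_map (hL.measurable _).aemeasurable hf.aestronglyMeasurable]

/-- The increments along the partition of `[0, T]` into `n` intervals of equal length are
independent and distributed as `L_{T/n}`. -/
theorem integral_prod_increments [IsProbabilityMeasure P] (hL : IsPureJumpLevy P b ν L) (T : ℝ≥0)
    {f : E d → ℂ} (hf : Continuous f) (n : ℕ) :
    ∫ ω, ∏ k ∈ Finset.range n, f (L (gridPoint T n (k + 1)) ω - L (gridPoint T n k) ω) ∂P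
      = (∫ ω, f (L (T / n) ω) ∂P) ^ n := by
  have hind := hL.indep n (fun i => gridPoint T n i)
    (fun i j hij => gridPoint_mono T n (Fin.val_le_of_le hij))
  have := hind.integral_fun_prod_comp (f := fun _ => f)
    (fun i => ((hL.measurable _).sub (hL.measurable _)).aemeasurable)
    (fun i => hf.aestronglyMeasurable)
  simp_rw [Finset.prod_range]
  simp only [Fin.val_succ, Fin.val_castSucc] at this
  rw [this]
  simp_rw [gridPoint_succ, hL.integral_comp_increment _ _ hf]
  simp

theorem aemeasurable_jumpSum_of_continuous (hL : IsPureJumpLevy P b ν L) (T : ℝ≥0)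
    {G : Type*} [NormedAddCommGroup G] [MeasurableSpace G] [BorelSpace G]
    [SecondCountableTopology G] {g : E d → G} (hg : Continuous g) {ε : ℝ} (hε : 0 < ε)
    (hg0 : ∀ y, ‖y‖ < ε → g y = 0) : AEMeasurable (fun ω => jumpSum g (fun t => L t ω) T) P := by
  refine aemeasurable_of_tendsto_metrizable_ae (u := atTop) (f := fun n ω => ∑ k ∈ Finset.range n,
      g (L (gridPoint T n (k + 1)) ω - L (gridPoint T n k) ω)) (fun n => ?_) ?_
  · refine Finset.aemeasurable_fun_sum _ fun k _ => ?_
    exact hg.measurable.comp_aemeasurable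
      ((hL.measurable _).sub (hL.measurable _)).aemeasurable
  · filter_upwards [hL.cadlag] with ω hω
    exact hω.tendsto_sum_increments T hg hε hg0

/-- The joint characteristic function of `L_T` and of a sum `∑_{s≤T} g(ΔL_s)`, for continuous `g`
vanishing near the origin. Both are limits of sums over the independent and identically distributed
increments along a partition of `[0, T]`. -/
theorem integral_exp_jumpSum_of_continuous [IsProbabilityMeasure P] (hL : IsPureJumpLevy P b ν L)
    (hν : IsLevyMeasure ν) (T : ℝ≥0) {g : E d → ℝ} (hg : Continuous g) {ε : ℝ} (hε : 0 < ε)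
    (hg0 : ∀ y, ‖y‖ < ε → g y = 0) (u : E d) :
    ∫ ω, Complex.exp (Complex.I *
        ((inner ℝ u (L T ω) + jumpSum g (fun t => L t ω) T : ℝ) : ℂ)) ∂P
      = Complex.exp (((T : ℝ) : ℂ) * (levyExponent b ν u
        + ∫ x, Complex.exp (Complex.I * ((inner ℝ u x : ℝ) : ℂ))
          * (Complex.exp (Complex.I * ((g x : ℝ) : ℂ)) - 1) ∂ν)) := by
  set f : E d → ℂ := fun x => Complex.exp (Complex.I * ((inner ℝ u x + g x : ℝ) : ℂ)) with hf
  have hfc : Continuous f := by fun_prop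
  set h : E d → ℂ := fun x => Complex.exp (Complex.I * ((inner ℝ u x : ℝ) : ℂ))
    * (Complex.exp (Complex.I * ((g x : ℝ) : ℂ)) - 1) with hh
  have hhb : ∀ x, ‖h x‖ ≤ 2 := fun x => by
    rw [hh, norm_mul, norm_exp_I_mul, one_mul]; exact norm_exp_I_mul_sub_one_le_two _
  have hhc : Continuous h := by fun_prop
  -- writing `f = e^{iu·x} + h`, the characteristic function of `L_{T/n}` accounts for the first
  -- summand and the small-time asymptotics for the second
  have hlim1 := hL.tendsto_nat_mul_integral hν T hhc hhb hε (fun x hx => by simp [hh, hg0 x hx])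
  have hlim2 := tendsto_nat_mul_exp_sub_one (((T : ℝ) : ℂ) * levyExponent b ν u)
  have hsum : Tendsto (fun n : ℕ => (n : ℂ) * ((∫ ω, f (L (T / n) ω) ∂P) - 1)) atTop
      (𝓝 (((T : ℝ) : ℂ) * (levyExponent b ν u + ∫ x, h x ∂ν))) := by
    rw [mul_add]
    refine (hlim2.add hlim1).congr fun n => ?_
    have e1 : ∫ ω, f (L (T / n) ω) ∂P
        = Complex.exp (((T : ℝ) : ℂ) * levyExponent b ν u / n) + ∫ ω, h (L (T / n) ω) ∂P := by
      have : Complex.exp (((T : ℝ) : ℂ) * levyExponent b ν u / n)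
          = Complex.exp ((((T / n : ℝ≥0) : ℝ) : ℂ) * levyExponent b ν u) := by
        push_cast; rw [mul_div_right_comm]
      rw [this, ← hL.charFun_eq, ← integral_add]
      · refine integral_congr_ae (Eventually.of_forall fun ω => ?_)
        simp only [hf, hh]
        push_cast
        rw [mul_add, Complex.exp_add]; ring
      · have := hL.measurable (T / n)
        exact Integrable.of_bound (by fun_prop) 1
          (Eventually.of_forall fun ω => (norm_exp_I_mul _).le)
      · exact Integrable.of_bound
          (hhc.measurable.comp (hL.measurable _)).aestronglyMeasurable 2
          (Eventually.of_forall fun ω => hhb _)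
    rw [e1]; ring
  have hpow := Complex.tendsto_one_add_pow_exp_of_tendsto hsum
  simp only [add_sub_cancel] at hpow
  refine tendsto_nhds_unique ?_ hpow
  -- the powers are the characteristic functions of the sums over the increments
  simp_rw [← hL.integral_prod_increments T hfc]
  refine tendsto_integral_of_dominated_convergence (fun _ => (1 : ℝ)) (fun n => ?_)
    (integrable_const _) (fun n => Eventually.of_forall fun ω => ?_) ?_
  · refine (Finset.measurable_fun_prod _ fun k _ => ?_).aestronglyMeasurable
    exact hfc.measurable.comp ((hL.measurable _).sub (hL.measurable _))
  · rw [norm_prod]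
    exact (Finset.prod_congr rfl fun k _ => norm_exp_I_mul _).trans Finset.prod_const_one |>.le
  · filter_upwards [hL.cadlag, hL.zero] with ω hω hω0
    have hlim := hω.tendsto_sum_increments T hg hε hg0
    have hcont : Tendsto (fun n : ℕ => Complex.exp (Complex.I * ((inner ℝ u (L T ω)
        + ∑ k ∈ Finset.range n, g (L (gridPoint T n (k + 1)) ω - L (gridPoint T n k) ω) : ℝ) : ℂ)))
        atTop (𝓝 (Complex.exp (Complex.I *
          ((inner ℝ u (L T ω) + jumpSum g (fun t => L t ω) T : ℝ) : ℂ)))) :=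
      ((Complex.continuous_exp.comp (continuous_const.mul Complex.continuous_ofReal)).tendsto
        _).comp (hlim.const_add _)
    refine hcont.congr' ?_
    filter_upwards [eventually_ne_atTop 0] with n hn
    rw [hf, ← Complex.exp_sum, ← Finset.mul_sum, ← Complex.ofReal_sum, Finset.sum_add_distrib,
      ← inner_sum, Finset.sum_range_sub (fun k => L (gridPoint T n k) ω), gridPoint_self T hn]
    have : gridPoint T n 0 = 0 := by simp [gridPoint]
    rw [this, hω0, sub_zero]

end IsPureJumpLevy

/-- Pointwise convergence of functions vanishing on a common ball passes to the sums over the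
jumps, because only finitely many jumps contribute. -/
theorem IsCadlag.tendsto_jumpSum {d : ℕ} {x : ℝ≥0 → E d} (hx : IsCadlag x) (T : ℝ≥0)
    {G : Type*} [AddCommMonoid G] [TopologicalSpace G] [ContinuousAdd G] {ι : Type*} {l : Filter ι}
    {g : ι → E d → G} {g' : E d → G} {ε : ℝ} (hε : 0 < ε)
    (hg0 : ∀ᶠ j in l, ∀ y, ‖y‖ < ε → g j y = 0) (hg0' : ∀ y, ‖y‖ < ε → g' y = 0)
    (hlim : ∀ y, Tendsto (fun j => g j y) l (𝓝 (g' y))) :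
    Tendsto (fun j => jumpSum (g j) x T) l (𝓝 (jumpSum g' x T)) := by
  obtain ⟨S, hS, hsmall⟩ := hx.exists_finset_jumpSum T hε
  rw [jumpSum_eq_sum hS fun s h0 hT hs => hg0' _ (hsmall s h0 hT hs)]
  refine (tendsto_finsetSum S fun s _ => hlim (jump x s)).congr' ?_
  filter_upwards [hg0] with j hj
  rw [jumpSum_eq_sum hS fun s h0 hT hs => hj _ (hsmall s h0 hT hs)]

/-- The vector `x` if its norm is at least `ε`, and `0` otherwise. -/
def cut {d : ℕ} (ε : ℝ) (x : E d) : E d := if ε ≤ ‖x‖ then x else 0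

theorem cut_of_lt {d : ℕ} {ε : ℝ} {x : E d} (h : ‖x‖ < ε) : cut ε x = 0 := if_neg (not_le.2 h)

theorem cut_of_le {d : ℕ} {ε : ℝ} {x : E d} (h : ε ≤ ‖x‖) : cut ε x = x := if_pos h

theorem measurable_cut {d : ℕ} (ε : ℝ) : Measurable (cut ε : E d → E d) :=
  Measurable.ite (measurableSet_le measurable_const measurable_norm) measurable_id measurable_const

/-- Continuous approximations of `cut ε` that vanish on the ball of radius `ε / 2`. -/
def smoothCut {d : ℕ} (ε : ℝ) (j : ℕ) (x : E d) : E d :=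
  max 0 (min 1 (1 - (j + 1) * ((ε - ‖x‖) * (2 / ε)))) • x

theorem continuous_smoothCut {d : ℕ} (ε : ℝ) (j : ℕ) : Continuous (smoothCut ε j : E d → E d) := by
  unfold smoothCut; fun_prop

theorem smoothCut_eq_zero {d : ℕ} {δ ε : ℝ} (hδ : 0 < δ) (hδε : δ ≤ ε) (j : ℕ) {x : E d}
    (hx : ‖x‖ < δ / 2) : smoothCut ε j x = 0 := by
  have hε := hδ.trans_le hδε
  have h1 : 1 ≤ (ε - ‖x‖) * (2 / ε) := by
    rw [mul_div_assoc', le_div_iff₀ hε]; linarith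
  have h2 : 1 - ((j : ℝ) + 1) * ((ε - ‖x‖) * (2 / ε)) ≤ 0 := by
    have : (0 : ℝ) ≤ j := by positivity
    nlinarith
  rw [smoothCut, max_eq_left ((min_le_right _ _).trans h2), zero_smul]

theorem tendsto_smoothCut {d : ℕ} {ε : ℝ} (hε : 0 < ε) (x : E d) :
    Tendsto (fun j => smoothCut ε j x) atTop (𝓝 (cut ε x)) := by
  rcases lt_or_ge ‖x‖ ε with hx | hx
  · rw [cut_of_lt hx]
    have hpos : 0 < (ε - ‖x‖) * (2 / ε) := mul_pos (sub_pos.2 hx) (by positivity)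
    refine tendsto_const_nhds.congr' ?_
    filter_upwards [eventually_ge_atTop ⌈1 / ((ε - ‖x‖) * (2 / ε))⌉₊] with j hj
    have h1 : 1 / ((ε - ‖x‖) * (2 / ε)) ≤ j := Nat.ceil_le.1 hj
    rw [div_le_iff₀ hpos] at h1
    rw [smoothCut, max_eq_left ((min_le_right _ _).trans (by nlinarith)), zero_smul]
  · rw [cut_of_le hx]
    refine tendsto_const_nhds.congr fun j => ?_
    have h1 : (ε - ‖x‖) * (2 / ε) ≤ 0 :=
      mul_nonpos_of_nonpos_of_nonneg (sub_nonpos.2 hx) (by positivity)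
    have h2 : 1 ≤ 1 - ((j : ℝ) + 1) * ((ε - ‖x‖) * (2 / ε)) := by
      have : (0 : ℝ) ≤ j := by positivity
      nlinarith
    rw [smoothCut, min_eq_left h2, max_eq_right zero_le_one, one_smul]

/-- The sum of the jumps of norm at least `ε` up to time `T`. -/
def bigJumps {d : ℕ} (ε : ℝ) (x : ℝ≥0 → E d) (T : ℝ≥0) : E d := jumpSum (cut ε) x T

/-- Linearity of the sum over the jumps. Without the common bound `δ` below all levels the sums
might be infinite and then `finsum` would not be additive. -/
theorem IsCadlag.jumpSum_sum_inner_cut {d : ℕ} {x : ℝ≥0 → E d} (hx : IsCadlag x) (T : ℝ≥0)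
    {ι : Type*} [Fintype ι] (v : ι → E d) {ε : ι → ℝ} {δ : ℝ} (hδ : 0 < δ) (hε : ∀ k, δ ≤ ε k) :
    jumpSum (fun y => ∑ k, (inner ℝ (v k) (cut (ε k) y) : ℝ)) x T
      = ∑ k, inner ℝ (v k) (bigJumps (ε k) x T) := by
  obtain ⟨S, hS, hsmall⟩ := hx.exists_finset_jumpSum T hδ
  have hz : ∀ k s, 0 < s → s ≤ T → s ∉ S → cut (ε k) (jump x s) = 0 := fun k s h0 hT hs =>
    cut_of_lt ((hsmall s h0 hT hs).trans_le (hε k))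
  rw [jumpSum_eq_sum hS fun s h0 hT hs => by simp [hz _ s h0 hT hs], Finset.sum_comm]
  refine Finset.sum_congr rfl fun k _ => ?_
  rw [bigJumps, jumpSum_eq_sum hS (hz k), inner_sum]

namespace IsPureJumpLevy

variable {d : ℕ} {Ω : Type*} [MeasurableSpace Ω] {P : Measure Ω}
  {b : E d} {ν : Measure (E d)} {L : ℝ≥0 → Ω → E d}

theorem aemeasurable_bigJumps (hL : IsPureJumpLevy P b ν L) (T : ℝ≥0) {ε : ℝ} (hε : 0 < ε) :
    AEMeasurable (fun ω => bigJumps ε (fun t => L t ω) T) P := by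
  refine aemeasurable_of_tendsto_metrizable_ae (u := atTop)
    (f := fun j ω => jumpSum (smoothCut ε j) (fun t => L t ω) T) (fun j => ?_) ?_
  · exact hL.aemeasurable_jumpSum_of_continuous T (continuous_smoothCut ε j) (half_pos hε)
      fun y hy => smoothCut_eq_zero hε le_rfl j hy
  · filter_upwards [hL.cadlag] with ω hω
    exact hω.tendsto_jumpSum T (half_pos hε)
      (Eventually.of_forall fun j y hy => smoothCut_eq_zero hε le_rfl j hy)
      (fun y hy => cut_of_lt (hy.trans (half_lt_self hε))) (tendsto_smoothCut hε)

/-- The joint characteristic function of `L_T` and of the sums of the jumps above several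
levels. -/
theorem integral_exp_bigJumps [IsProbabilityMeasure P] (hL : IsPureJumpLevy P b ν L)
    (hν : IsLevyMeasure ν) (T : ℝ≥0) {ι : Type*} [Fintype ι] (v : ι → E d) {ε : ι → ℝ}
    {δ : ℝ} (hδ : 0 < δ) (hε : ∀ k, δ ≤ ε k) (u : E d) :
    ∫ ω, Complex.exp (Complex.I * ((inner ℝ u (L T ω)
        + ∑ k, inner ℝ (v k) (bigJumps (ε k) (fun t => L t ω) T) : ℝ) : ℂ)) ∂P
      = Complex.exp (((T : ℝ) : ℂ) * (levyExponent b ν u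
        + ∫ x, Complex.exp (Complex.I * ((inner ℝ u x : ℝ) : ℂ))
          * (Complex.exp (Complex.I * ((∑ k, inner ℝ (v k) (cut (ε k) x) : ℝ) : ℂ)) - 1) ∂ν)) := by
  set g : ℕ → E d → ℝ := fun j y => ∑ k, inner ℝ (v k) (smoothCut (ε k) j y) with hg
  set g' : E d → ℝ := fun y => ∑ k, inner ℝ (v k) (cut (ε k) y) with hg'
  have hgc : ∀ j, Continuous (g j) := fun j => continuous_finsetSum _ fun k _ =>
    continuous_const.inner (continuous_smoothCut _ _)
  have hg0 : ∀ j y, ‖y‖ < δ / 2 → g j y = 0 := fun j y hy => by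
    simp [hg, fun k => smoothCut_eq_zero hδ (hε k) j hy]
  have hg0' : ∀ y, ‖y‖ < δ / 2 → g' y = 0 := fun y hy => by
    simp [hg', fun k => cut_of_lt (ε := ε k) (x := y)
      (hy.trans ((half_lt_self hδ).trans_le (hε k)))]
  have hlim : ∀ y, Tendsto (fun j => g j y) atTop (𝓝 (g' y)) := fun y =>
    tendsto_finsetSum _ fun k _ =>
      tendsto_const_nhds.inner (tendsto_smoothCut (hδ.trans_le (hε k)) y)
  have hc : Continuous fun y : ℝ => Complex.exp (Complex.I * (y : ℂ)) := by fun_prop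
  have h1 : Tendsto (fun j => ∫ ω, Complex.exp (Complex.I *
        ((inner ℝ u (L T ω) + jumpSum (g j) (fun t => L t ω) T : ℝ) : ℂ)) ∂P) atTop
      (𝓝 (∫ ω, Complex.exp (Complex.I * ((inner ℝ u (L T ω)
        + ∑ k, inner ℝ (v k) (bigJumps (ε k) (fun t => L t ω) T) : ℝ) : ℂ)) ∂P)) := by
    refine tendsto_integral_of_dominated_convergence (fun _ => (1 : ℝ)) (fun j => ?_)
      (integrable_const _) (fun n => Eventually.of_forall fun ω => (norm_exp_I_mul _).le) ?_
    · have e1 := hL.aemeasurable_jumpSum_of_continuous T (hgc j) (half_pos hδ) (hg0 j)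
      have e2 := hL.measurable T
      exact (hc.measurable.comp_aemeasurable
        ((measurable_const.inner e2).aemeasurable.add e1)).aestronglyMeasurable
    · filter_upwards [hL.cadlag] with ω hω
      rw [← hω.jumpSum_sum_inner_cut T v hδ hε]
      exact (hc.tendsto _).comp ((hω.tendsto_jumpSum T (half_pos hδ)
        (Eventually.of_forall hg0) hg0' hlim).const_add _)
  have h2 : Tendsto (fun j => ∫ x, Complex.exp (Complex.I * ((inner ℝ u x : ℝ) : ℂ))
          * (Complex.exp (Complex.I * ((g j x : ℝ) : ℂ)) - 1) ∂ν) atTop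
      (𝓝 (∫ x, Complex.exp (Complex.I * ((inner ℝ u x : ℝ) : ℂ))
          * (Complex.exp (Complex.I * ((g' x : ℝ) : ℂ)) - 1) ∂ν)) := by
    refine tendsto_integral_of_dominated_convergence
      ({x | δ / 2 ≤ ‖x‖}.indicator fun _ => (2 : ℝ)) (fun j => ?_) ?_
      (fun j => Eventually.of_forall fun x => ?_) (Eventually.of_forall fun x => ?_)
    · have := hgc j
      exact Continuous.aestronglyMeasurable (by fun_prop)
    · rw [integrable_indicator_iff (measurableSet_le measurable_const measurable_norm)]
      exact integrableOn_const (hν.measure_norm_ge_lt_top (half_pos hδ)).ne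
    · by_cases hx : δ / 2 ≤ ‖x‖
      · rw [indicator_of_mem (by exact hx), norm_mul, norm_exp_I_mul, one_mul]
        exact norm_exp_I_mul_sub_one_le_two _
      · rw [indicator_of_notMem (by exact hx), hg0 j x (not_le.1 hx)]
        simp
    · exact (((hc.tendsto _).comp (hlim x)).sub_const 1).const_mul _
  refine tendsto_nhds_unique h1 ?_
  simp_rw [fun j => hL.integral_exp_jumpSum_of_continuous hν T (hgc j) (half_pos hδ) (hg0 j) u]
  exact (Complex.continuous_exp.tendsto _).comp ((h2.const_add _).const_mul _)

end IsPureJumpLevy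

/-! ### Moments, independence and maximal inequalities -/

section Probability

variable {Ω : Type*} [MeasurableSpace Ω] {P : Measure Ω} [IsProbabilityMeasure P]

theorem tendsto_nat_mul_sin (x : ℝ) :
    Tendsto (fun n : ℕ => (n : ℝ) * Real.sin ((n : ℝ)⁻¹ * x)) atTop (𝓝 x) := by
  have h2 : HasDerivAt (fun t : ℝ => Real.sin (t * x)) x 0 := by
    simpa using (((hasDerivAt_id (0 : ℝ)).mul_const x).sin)
  have h3 := h2.tendsto_slope_zero
  have h4 : Tendsto (fun n : ℕ => ((n : ℝ))⁻¹) atTop (𝓝[≠] 0) := by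
    refine tendsto_nhdsWithin_iff.2 ⟨tendsto_inv_atTop_nhds_zero_nat (𝕜 := ℝ), ?_⟩
    filter_upwards [eventually_ne_atTop 0] with n hn
    simpa using hn
  refine (h3.comp h4).congr fun n => ?_
  simp

theorem integral_abs_le_sqrt {X : Ω → ℝ} (hX : MemLp X 2 P) {C : ℝ}
    (h : ∫ ω, X ω ^ 2 ∂P ≤ C) : ∫ ω, |X ω| ∂P ≤ √C := by
  have h1 := variance_nonneg |X| P
  rw [variance_eq_sub hX.abs] at h1
  simp only [Pi.pow_apply, Pi.abs_apply, sq_abs] at h1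
  exact Real.le_sqrt_of_sq_le (by linarith)

/-- A quadratic bound on `φ - 1` for the characteristic function `φ` of `X` gives a finite second
moment by Fatou's lemma, and then a vanishing mean. -/
theorem moments_of_norm_charFun_sub_one_le {X : Ω → ℝ} (hX : AEMeasurable X P) {C : ℝ}
    (h : ∀ s : ℝ, ‖∫ ω, Complex.exp (Complex.I * ((s * X ω : ℝ) : ℂ)) ∂P - 1‖ ≤ C * s ^ 2) :
    Integrable X P ∧ ∫ ω, X ω ∂P = 0 ∧ ∫ ω, |X ω| ∂P ≤ √(2 * C) := by
  have hC : 0 ≤ C := by simpa using (norm_nonneg _).trans (h 1)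
  have hint : ∀ s : ℝ, Integrable (fun ω => Complex.exp (Complex.I * ((s * X ω : ℝ) : ℂ))) P :=
    fun s => Integrable.of_bound (by fun_prop) 1 (Eventually.of_forall fun ω => (norm_exp_I_mul _).le)
  have hexp : ∀ y : ℝ, Complex.exp (Complex.I * (y : ℂ)) = ⟨Real.cos y, Real.sin y⟩ := fun y => by
    rw [mul_comm, Complex.exp_mul_I]
    apply Complex.ext <;> simp [Complex.cos_ofReal_re, Complex.sin_ofReal_re]
  have hre : ∀ s : ℝ, ∫ ω, (1 - Real.cos (s * X ω)) ∂P ≤ C * s ^ 2 := fun s => by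
    have e1 : ∫ ω, Real.cos (s * X ω) ∂P
        = (∫ ω, Complex.exp (Complex.I * ((s * X ω : ℝ) : ℂ)) ∂P).re := by
      have := integral_re (hint s)
      simp only [hexp] at this ⊢
      exact this
    have e2 : Integrable (fun ω => Real.cos (s * X ω)) P :=
      Integrable.of_bound (by fun_prop) 1 (Eventually.of_forall fun ω => Real.abs_cos_le_one _)
    rw [integral_sub (integrable_const _) e2, e1]
    have := (Complex.abs_re_le_norm _).trans (h s)
    rw [Complex.sub_re, Complex.one_re, abs_sub_comm] at this
    simpa using (le_abs_self _).trans this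
  have him : ∀ s : ℝ, |∫ ω, Real.sin (s * X ω) ∂P| ≤ C * s ^ 2 := fun s => by
    have e1 : ∫ ω, Real.sin (s * X ω) ∂P
        = (∫ ω, Complex.exp (Complex.I * ((s * X ω : ℝ) : ℂ)) ∂P).im := by
      have := integral_im (hint s)
      simp only [hexp] at this ⊢
      exact this
    rw [e1]
    have := (Complex.abs_im_le_norm _).trans (h s)
    rwa [Complex.sub_im, Complex.one_im, sub_zero] at this
  have hsq : ∫⁻ ω, ENNReal.ofReal (X ω ^ 2) ∂P ≤ ENNReal.ofReal (2 * C) := by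
    have hb : ∀ n : ℕ, ∫⁻ ω, ENNReal.ofReal (((n : ℝ) * Real.sin ((n : ℝ)⁻¹ * X ω)) ^ 2) ∂P
        ≤ ENNReal.ofReal (2 * C) := by
      intro n
      have e2 : Integrable (fun ω => ((n : ℝ) * Real.sin ((n : ℝ)⁻¹ * X ω)) ^ 2) P := by
        refine Integrable.of_bound (by fun_prop) ((n : ℝ) ^ 2) (Eventually.of_forall fun ω => ?_)
        rw [Real.norm_of_nonneg (sq_nonneg _), mul_pow]
        exact mul_le_of_le_one_right (by positivity) (Real.sin_sq_le_one _)
      rw [← ofReal_integral_eq_lintegral_ofReal e2 (Eventually.of_forall fun ω => sq_nonneg _)]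
      refine ENNReal.ofReal_le_ofReal ?_
      -- the squares of `n sin(X / n)` approximate `X²` and are bounded by means of the real part of
      -- the characteristic function at `2 / n`
      have e3 : ∀ ω, ((n : ℝ) * Real.sin ((n : ℝ)⁻¹ * X ω)) ^ 2
          = (n : ℝ) ^ 2 / 2 * (1 - Real.cos ((2 * (n : ℝ)⁻¹) * X ω)) := fun ω => by
        rw [mul_assoc 2, Real.cos_two_mul, mul_pow, Real.sin_sq]; ring
      simp_rw [e3]
      rw [integral_const_mul]
      refine (mul_le_mul_of_nonneg_left (hre _) (by positivity)).trans ?_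
      rcases eq_or_ne n 0 with rfl | hn
      · simpa using hC
      · field_simp
        norm_num
    refine (lintegral_mono fun ω => ?_).trans ((lintegral_liminf_le' (u := atTop)
      (f := fun (n : ℕ) ω => ENNReal.ofReal (((n : ℝ) * Real.sin ((n : ℝ)⁻¹ * X ω)) ^ 2))
      fun n => ?_).trans (liminf_le_of_le (by isBoundedDefault) fun c hc => ?_))
    · have := (ENNReal.continuous_ofReal.tendsto _).comp ((tendsto_nat_mul_sin (X ω)).pow 2)
      exact this.liminf_eq.ge
    · fun_prop
    · obtain ⟨n, hn⟩ := hc.exists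
      exact hn.trans (hb n)
  have hL2 : MemLp X 2 P := by
    rw [memLp_two_iff_integrable_sq hX.aestronglyMeasurable]
    refine ⟨by fun_prop, ?_⟩
    rw [hasFiniteIntegral_iff_ofReal (Eventually.of_forall fun ω => sq_nonneg _)]
    exact hsq.trans_lt ENNReal.ofReal_lt_top
  have hL1 : Integrable X P := hL2.integrable (by norm_num)
  refine ⟨hL1, ?_, integral_abs_le_sqrt hL2 ?_⟩
  · have h1 : Tendsto (fun n : ℕ => ∫ ω, (n : ℝ) * Real.sin ((n : ℝ)⁻¹ * X ω) ∂P) atTop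
        (𝓝 (∫ ω, X ω ∂P)) := by
      refine tendsto_integral_of_dominated_convergence (fun ω => |X ω|) (fun n => by fun_prop)
        hL1.abs (fun n => Eventually.of_forall fun ω => ?_)
        (Eventually.of_forall fun ω => tendsto_nat_mul_sin _)
      rcases eq_or_ne n 0 with rfl | hn
      · simp
      · rw [norm_mul, Real.norm_eq_abs, Real.norm_eq_abs]
        refine (mul_le_mul_of_nonneg_left Real.abs_sin_le_abs (abs_nonneg _)).trans ?_
        rw [← abs_mul, ← mul_assoc, mul_inv_cancel₀ (by positivity), one_mul]
    have h2 : Tendsto (fun n : ℕ => ∫ ω, (n : ℝ) * Real.sin ((n : ℝ)⁻¹ * X ω) ∂P) atTop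
        (𝓝 0) := by
      refine squeeze_zero_norm (a := fun n : ℕ => C * (n : ℝ)⁻¹) (fun n => ?_) ?_
      · rw [integral_const_mul, norm_mul, Real.norm_eq_abs, Real.norm_eq_abs, Nat.abs_cast]
        refine (mul_le_mul_of_nonneg_left (him _) (by positivity)).trans ?_
        rcases eq_or_ne n 0 with rfl | hn
        · simp
        · field_simp; rfl
      · simpa using (tendsto_inv_atTop_nhds_zero_nat (𝕜 := ℝ)).const_mul C
    exact tendsto_nhds_unique h1 h2
  · rw [integral_eq_lintegral_of_nonneg_ae (Eventually.of_forall fun ω => sq_nonneg _)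
      (by fun_prop)]
    exact ENNReal.toReal_le_of_le_ofReal (by positivity) hsq

/-- Real random variables whose joint characteristic function is a product of functions of one
variable are independent. -/
theorem iIndepFun_of_charFun_eq_prod {ι : Type*} [Fintype ι] {Y : ι → Ω → ℝ}
    (hY : ∀ k, AEMeasurable (Y k) P) (φ : ι → ℝ → ℂ) (hφ : ∀ k, φ k 0 = 1)
    (h : ∀ t : ι → ℝ, ∫ ω, Complex.exp (Complex.I * ((∑ k, t k * Y k ω : ℝ) : ℂ)) ∂P
      = ∏ k, φ k (t k)) : iIndepFun Y P := by
  classical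
  rw [iIndepFun_iff_charFun_pi hY]
  intro t
  have h1 : ∀ k, charFun (P.map (Y k)) (t k) = φ k (t k) := by
    intro k
    rw [charFun_apply, integral_map (hY k) (by fun_prop)]
    have := h (Pi.single k (t k))
    rw [Finset.prod_eq_single k (fun j _ hj => by rw [Pi.single_eq_of_ne hj, hφ]) (by simp),
      Pi.single_eq_same] at this
    rw [← this]
    refine integral_congr_ae (Eventually.of_forall fun ω => ?_)
    simp only
    rw [Finset.sum_eq_single k (fun j _ hj => by rw [Pi.single_eq_of_ne hj, zero_mul]) (by simp),
      Pi.single_eq_same, mul_comm Complex.I]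
    simp
  simp_rw [h1]
  rw [← h, charFun_apply, integral_map (by fun_prop) (by fun_prop)]
  refine integral_congr_ae (Eventually.of_forall fun ω => ?_)
  simp only [PiLp.inner_apply, mul_comm Complex.I]
  simp

/-- The case of strongly measurable variables, for which the natural filtration is defined. -/
theorem mul_measure_le_of_iIndepFun_of_stronglyMeasurable {Y : ℕ → Ω → ℝ}
    (hm : ∀ k, StronglyMeasurable (Y k)) (hint : ∀ k, Integrable (Y k) P) (hind : iIndepFun Y P)
    (hmean : ∀ k, ∫ ω, Y k ω ∂P = 0) (a : ℝ≥0) (n : ℕ) :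
    a * P {ω | ∃ k ≤ n, (a : ℝ) ≤ |∑ j ∈ Finset.range (k + 1), Y j ω|}
      ≤ ENNReal.ofReal (∫ ω, |∑ j ∈ Finset.range (n + 1), Y j ω| ∂P) := by
  set F := Filtration.natural Y hm
  set M : ℕ → Ω → ℝ := fun k ω => ∑ j ∈ Finset.range (k + 1), Y j ω with hM
  have hMint : ∀ k, Integrable (M k) P := fun k => integrable_finsetSum _ fun j _ => hint j
  have hadp : StronglyAdapted F M := fun k => by
    refine Finset.stronglyMeasurable_fun_sum _ fun j hj => ?_
    exact (Filtration.stronglyAdapted_natural hm j).mono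
      (F.mono (Nat.lt_succ_iff.1 (Finset.mem_range.1 hj)))
  have hmart : Martingale M F P := by
    refine martingale_of_condExp_sub_eq_zero_nat hadp hMint fun k => ?_
    have e : M (k + 1) - M k = Y (k + 1) := by
      ext ω; simp [hM, Finset.sum_range_succ _ (k + 1)]
    rw [e]
    refine (hind.condExp_natural_ae_eq_of_lt hm (Nat.lt_succ_self k)).trans ?_
    rw [hmean]; rfl
  have hsub : Submartingale (fun k ω => |M k ω|) F P := by
    have := hmart.submartingale.sup hmart.neg.submartingale
    exact this
  have hmax := maximal_ineq hsub (fun k ω => abs_nonneg _) (ε := a) n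
  have hset : {ω | ∃ k ≤ n, (a : ℝ) ≤ |∑ j ∈ Finset.range (k + 1), Y j ω|}
      = {ω | (a : ℝ) ≤ (Finset.range (n + 1)).sup' Finset.nonempty_range_add_one
          fun k => |M k ω|} := by
    ext ω
    simp [Finset.le_sup'_iff, hM]
  rw [hset]
  refine hmax.trans (ENNReal.ofReal_le_ofReal ?_)
  exact setIntegral_le_integral (hsub.integrable n) (Eventually.of_forall fun ω => abs_nonneg _)

/-- Doob's maximal inequality for partial sums of independent centred random variables. -/
theorem mul_measure_le_of_iIndepFun {Y : ℕ → Ω → ℝ}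
    (hint : ∀ k, Integrable (Y k) P) (hind : iIndepFun Y P)
    (hmean : ∀ k, ∫ ω, Y k ω ∂P = 0) (a : ℝ≥0) (n : ℕ) :
    a * P {ω | ∃ k ≤ n, (a : ℝ) ≤ |∑ j ∈ Finset.range (k + 1), Y j ω|}
      ≤ ENNReal.ofReal (∫ ω, |∑ j ∈ Finset.range (n + 1), Y j ω| ∂P) := by
  set Y' : ℕ → Ω → ℝ := fun k => (hint k).1.mk (Y k)
  have hYY : ∀ k, Y k =ᵐ[P] Y' k := fun k => (hint k).1.ae_eq_mk
  have hall : ∀ᵐ ω ∂P, ∀ k, Y k ω = Y' k ω := ae_all_iff.2 hYY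
  have key := mul_measure_le_of_iIndepFun_of_stronglyMeasurable (Y := Y')
    (fun k => (hint k).1.stronglyMeasurable_mk) (fun k => (hint k).congr (hYY k))
    (hind.congr hYY) (fun k => by rw [← integral_congr_ae (hYY k), hmean]) a n
  have e1 : P {ω | ∃ k ≤ n, (a : ℝ) ≤ |∑ j ∈ Finset.range (k + 1), Y j ω|}
      = P {ω | ∃ k ≤ n, (a : ℝ) ≤ |∑ j ∈ Finset.range (k + 1), Y' j ω|} := by
    refine measure_congr ?_
    filter_upwards [hall] with ω hω
    simp only [eq_iff_iff]
    change (∃ k ≤ n, (a : ℝ) ≤ |∑ j ∈ Finset.range (k + 1), Y j ω|)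
      ↔ (∃ k ≤ n, (a : ℝ) ≤ |∑ j ∈ Finset.range (k + 1), Y' j ω|)
    simp_rw [hω]
  have e2 : ∫ ω, |∑ j ∈ Finset.range (n + 1), Y j ω| ∂P
      = ∫ ω, |∑ j ∈ Finset.range (n + 1), Y' j ω| ∂P := by
    refine integral_congr_ae ?_
    filter_upwards [hall] with ω hω
    simp_rw [hω]
  rwa [e1, e2]

end Probability

/-! ### Joint characteristic function of the truncations -/

/-- The test vector `v` if the jump `x` has norm at least `ε`, and `0` otherwise. -/
def testAbove {d : ℕ} (ε : ℝ) (v x : E d) : E d := if ε ≤ ‖x‖ then v else 0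

theorem testAbove_of_lt {d : ℕ} {ε : ℝ} {v x : E d} (h : ‖x‖ < ε) : testAbove ε v x = 0 :=
  if_neg (not_le.2 h)

theorem testAbove_of_le {d : ℕ} {ε : ℝ} {v x : E d} (h : ε ≤ ‖x‖) : testAbove ε v x = v :=
  if_pos h

/-- The vector `x` if `ε ≤ ‖x‖ ≤ 1`, and `0` otherwise. -/
def midCut {d : ℕ} (ε : ℝ) : E d → E d := {x : E d | ε ≤ ‖x‖ ∧ ‖x‖ ≤ 1}.indicator fun x => x

theorem measurableSet_annulus {d : ℕ} (ε : ℝ) : MeasurableSet {x : E d | ε ≤ ‖x‖ ∧ ‖x‖ ≤ 1} :=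
  (measurableSet_le measurable_const measurable_norm).inter
    (measurableSet_le measurable_norm measurable_const)

theorem measurable_midCut {d : ℕ} (ε : ℝ) : Measurable (midCut ε : E d → E d) :=
  measurable_id.indicator (measurableSet_annulus ε)

theorem norm_midCut_le {d : ℕ} {δ ε : ℝ} (h : δ ≤ ε) (x : E d) :
    ‖midCut ε x‖ ≤ {x : E d | δ ≤ ‖x‖}.indicator (fun _ => (1 : ℝ)) x := by
  by_cases hx : ε ≤ ‖x‖ ∧ ‖x‖ ≤ 1
  · rw [midCut, indicator_of_mem (by exact hx), indicator_of_mem (by exact h.trans hx.1)]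
    exact hx.2
  · rw [midCut, indicator_of_notMem (by exact hx), norm_zero]
    exact indicator_nonneg (fun _ _ => zero_le_one) _

theorem IsLevyMeasure.integrable_indicator_norm_ge {d : ℕ} {ν : Measure (E d)}
    (hν : IsLevyMeasure ν) {δ : ℝ} (hδ : 0 < δ) (c : ℝ) :
    Integrable ({x : E d | δ ≤ ‖x‖}.indicator fun _ => c) ν := by
  rw [integrable_indicator_iff (measurableSet_le measurable_const measurable_norm)]
  exact integrableOn_const (hν.measure_norm_ge_lt_top hδ).ne

theorem IsLevyMeasure.integrable_midCut {d : ℕ} {ν : Measure (E d)}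
    (hν : IsLevyMeasure ν) {ε : ℝ} (hε : 0 < ε) : Integrable (midCut ε) ν :=
  (hν.integrable_indicator_norm_ge hε 1).mono' (measurable_midCut ε).aestronglyMeasurable
    (Eventually.of_forall (norm_midCut_le le_rfl))

/-- The compensator `∫_{ε ≤ |x| ≤ 1} x ν(dx)` as the integral of `midCut ε`. -/
theorem integral_midCut {d : ℕ} (ν : Measure (E d)) (ε : ℝ) :
    ∫ x, midCut ε x ∂ν = ∫ x in {x : E d | ε ≤ ‖x‖ ∧ ‖x‖ ≤ 1}, x ∂ν :=
  integral_indicator (measurableSet_annulus ε)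

/-- Left-continuity in the level: the condition `ε ≤ ‖x‖` is closed in `ε`. -/
theorem tendsto_nhdsLE_ite {d : ℕ} {ε : ℝ} (x : E d) (c : E d) :
    Tendsto (fun ε' : ℝ => if ε' ≤ ‖x‖ then c else 0) (𝓝[≤] ε)
      (𝓝 (if ε ≤ ‖x‖ then c else 0)) := by
  refine tendsto_const_nhds.congr' ?_
  rcases lt_or_ge ‖x‖ ε with hx | hx
  · filter_upwards [mem_nhdsWithin_of_mem_nhds (Ioi_mem_nhds hx)] with ε' hε'
    rw [if_neg (not_le.2 hx), if_neg (not_le.2 hε')]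
  · filter_upwards [self_mem_nhdsWithin] with ε' hε'
    rw [if_pos hx, if_pos (le_trans hε' hx)]

theorem midCut_eq_ite {d : ℕ} (ε : ℝ) (x : E d) :
    midCut ε x = if ε ≤ ‖x‖ then (if ‖x‖ ≤ 1 then x else 0) else 0 := by
  simp only [midCut, indicator_apply, mem_ofPred_eq, ite_and]

theorem IsLevyMeasure.tendsto_integral_midCut {d : ℕ} {ν : Measure (E d)}
    (hν : IsLevyMeasure ν) {ε : ℝ} (hε : 0 < ε) :
    Tendsto (fun ε' => ∫ x, midCut ε' x ∂ν) (𝓝[≤] ε) (𝓝 (∫ x, midCut ε x ∂ν)) := by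
  refine tendsto_integral_filter_of_dominated_convergence
    ({x : E d | ε / 2 ≤ ‖x‖}.indicator fun _ => (1 : ℝ))
    (Eventually.of_forall fun ε' => (measurable_midCut ε').aestronglyMeasurable) ?_
    (hν.integrable_indicator_norm_ge (half_pos hε) 1) (Eventually.of_forall fun x => ?_)
  · filter_upwards [mem_nhdsWithin_of_mem_nhds (Ioi_mem_nhds (half_lt_self hε))] with ε' hε'
    exact Eventually.of_forall (norm_midCut_le (le_of_lt hε'))
  · simp_rw [midCut_eq_ite]
    exact tendsto_nhdsLE_ite x _

section Path

variable {d : ℕ} {Ω : Type*} {b : E d} {ν : Measure (E d)} {L : ℝ≥0 → Ω → E d}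

/-- The truncation is the sum of the jumps of norm at least `ε` plus a deterministic vector. For
`ε ≤ 1` the two sums over jumps in its definition are disjoint and exhaust these jumps. -/
theorem truncated_eq {ω : Ω} (hω : IsCadlag fun t => L t ω) {ε : ℝ} (hε : 0 < ε) (hε1 : ε ≤ 1)
    (T : ℝ≥0) : truncated b ν L ε T ω
      = bigJumps ε (fun t => L t ω) T + (T : ℝ) • (b - ∫ x, midCut ε x ∂ν) := by
  obtain ⟨S, hS, hsmall⟩ := hω.exists_finset_jumpSum T hε
  set x : ℝ≥0 → E d := fun t => L t ω
  have hfin : ∀ (p : ℝ≥0 → Prop) [DecidablePred p], (∀ s, p s → ε ≤ ‖jump x s‖) →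
      ∑ᶠ s ∈ {s : ℝ≥0 | 0 < s ∧ s ≤ T ∧ p s}, jump x s = ∑ s ∈ S.filter p, jump x s := by
    intro p _ hp
    refine finsum_mem_eq_sum_of_inter_support_eq _ ?_
    congr 1
    ext s
    simp only [mem_ofPred_eq, Finset.coe_filter]
    constructor
    · rintro ⟨h1, h2, h3⟩
      exact ⟨by_contra fun hc => absurd (hp s h3) (not_le.2 (hsmall s h1 h2 hc)), h3⟩
    · rintro ⟨h1, h3⟩
      exact ⟨(hS s h1).1, (hS s h1).2, h3⟩
  have h1 := hfin (fun s => 1 < ‖jump x s‖) fun s hs => hε1.trans hs.le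
  have h2 := hfin (fun s => ε ≤ ‖jump x s‖ ∧ ‖jump x s‖ ≤ 1) fun s hs => hs.1
  have h3 : bigJumps ε x T = ∑ s ∈ S, cut ε (jump x s) :=
    jumpSum_eq_sum hS fun s h0 hT hs => cut_of_lt (hsmall s h0 hT hs)
  have h4 : ∑ s ∈ S, cut ε (jump x s) = (∑ s ∈ S.filter fun s => 1 < ‖jump x s‖, jump x s)
      + ∑ s ∈ S.filter fun s => ε ≤ ‖jump x s‖ ∧ ‖jump x s‖ ≤ 1, jump x s := by
    rw [Finset.sum_filter, Finset.sum_filter, ← Finset.sum_add_distrib]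
    refine Finset.sum_congr rfl fun s _ => ?_
    unfold cut
    by_cases ha : 1 < ‖jump x s‖
    · simp [ha, hε1.trans ha.le, not_le.2 ha]
    · simp [ha, not_lt.1 ha]
  unfold truncated
  rw [h1, h2, h3, h4, ← integral_midCut, smul_sub]
  abel

/-- Path by path, the truncation is left-continuous in the level. -/
theorem tendsto_truncated_nhdsLE (hν : IsLevyMeasure ν) {ω : Ω} (hω : IsCadlag fun t => L t ω)
    {ε : ℝ} (hε : 0 < ε) (hε1 : ε ≤ 1) (T : ℝ≥0) :
    Tendsto (fun ε' => truncated b ν L ε' T ω) (𝓝[≤] ε) (𝓝 (truncated b ν L ε T ω)) := by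
  rw [truncated_eq hω hε hε1]
  have h1 : Tendsto (fun ε' => bigJumps ε' (fun t => L t ω) T) (𝓝[≤] ε)
      (𝓝 (bigJumps ε (fun t => L t ω) T)) := by
    refine hω.tendsto_jumpSum T (half_pos hε) ?_
      (fun y hy => cut_of_lt (hy.trans (half_lt_self hε))) (fun y => tendsto_nhdsLE_ite y y)
    filter_upwards [mem_nhdsWithin_of_mem_nhds (Ioi_mem_nhds (half_lt_self hε))] with ε' hε' y hy
    exact cut_of_lt (hy.trans hε')
  refine (h1.add ((tendsto_const_nhds.sub (hν.tendsto_integral_midCut hε)).const_smul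
    (T : ℝ))).congr' ?_
  filter_upwards [self_mem_nhdsWithin, mem_nhdsWithin_of_mem_nhds (Ioi_mem_nhds hε)]
    with ε' h1 h2
  exact (truncated_eq hω h2 (le_trans h1 hε1) T).symm

end Path

namespace IsPureJumpLevy

variable {d : ℕ} {Ω : Type*} [MeasurableSpace Ω] {P : Measure Ω}
  {b : E d} {ν : Measure (E d)} {L : ℝ≥0 → Ω → E d}

theorem aemeasurable_truncated (hL : IsPureJumpLevy P b ν L) {ε : ℝ} (hε : 0 < ε) (hε1 : ε ≤ 1)
    (T : ℝ≥0) : AEMeasurable (truncated b ν L ε T) P := by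
  refine ((hL.aemeasurable_bigJumps T hε).add_const
    ((T : ℝ) • (b - ∫ x, midCut ε x ∂ν))).congr ?_
  filter_upwards [hL.cadlag] with ω hω
  exact (truncated_eq hω hε hε1 T).symm

/-- The joint characteristic function of `L_T` and finitely many truncations: jumps of size `‖x‖`
are tested with `u` plus the sum of all `v k` with `ε k ≤ ‖x‖`. -/
theorem integral_exp_truncated [IsProbabilityMeasure P] (hL : IsPureJumpLevy P b ν L)
    (hν : IsLevyMeasure ν) (T : ℝ≥0) {ι : Type*} [Fintype ι] (u : E d) (v : ι → E d)
    {ε : ι → ℝ} {δ : ℝ} (hδ : 0 < δ) (hε : ∀ k, δ ≤ ε k) (hε1 : ∀ k, ε k ≤ 1) :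
    ∫ ω, Complex.exp (Complex.I * ((inner ℝ u (L T ω)
        + ∑ k, inner ℝ (v k) (truncated b ν L (ε k) T ω) : ℝ) : ℂ)) ∂P
      = Complex.exp (((T : ℝ) : ℂ) * (Complex.I * ((inner ℝ b (u + ∑ k, v k) : ℝ) : ℂ)
        + ∫ x, levyKernel (u + ∑ k, testAbove (ε k) (v k) x) x ∂ν)) := by
  set c : ℝ := ∑ k, inner ℝ (v k) ((T : ℝ) • (b - ∫ x, midCut (ε k) x ∂ν)) with hc
  have h1 : ∫ ω, Complex.exp (Complex.I * ((inner ℝ u (L T ω)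
        + ∑ k, inner ℝ (v k) (truncated b ν L (ε k) T ω) : ℝ) : ℂ)) ∂P
      = ∫ ω, Complex.exp (Complex.I * (c : ℂ)) * Complex.exp (Complex.I * ((inner ℝ u (L T ω)
        + ∑ k, inner ℝ (v k) (bigJumps (ε k) (fun t => L t ω) T) : ℝ) : ℂ)) ∂P := by
    refine integral_congr_ae ?_
    filter_upwards [hL.cadlag] with ω hω
    rw [← Complex.exp_add, ← mul_add, ← Complex.ofReal_add]
    congr 3
    have : ∀ k, truncated b ν L (ε k) T ω = bigJumps (ε k) (fun t => L t ω) T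
        + (T : ℝ) • (b - ∫ x, midCut (ε k) x ∂ν) := fun k =>
      truncated_eq hω (hδ.trans_le (hε k)) (hε1 k) T
    simp_rw [this, inner_add_right, Finset.sum_add_distrib]
    rw [hc]; ring
  rw [h1, integral_const_mul, hL.integral_exp_bigJumps hν T v hδ hε u, ← Complex.exp_add]
  congr 1
  set A : E d → ℂ := fun x => Complex.exp (Complex.I * ((inner ℝ u x : ℝ) : ℂ))
    * (Complex.exp (Complex.I * ((∑ k, inner ℝ (v k) (cut (ε k) x) : ℝ) : ℂ)) - 1) with hA
  have hAint : Integrable A ν := by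
    refine (hν.integrable_indicator_norm_ge hδ 2).mono' ?_ (Eventually.of_forall fun x => ?_)
    · have := fun k => measurable_cut (d := d) (ε k)
      exact Measurable.aestronglyMeasurable (by fun_prop)
    · by_cases hx : δ ≤ ‖x‖
      · rw [indicator_of_mem (by exact hx), hA, norm_mul, norm_exp_I_mul, one_mul]
        exact norm_exp_I_mul_sub_one_le_two _
      · have : ∀ k, cut (ε k) x = 0 := fun k => cut_of_lt ((not_le.1 hx).trans_le (hε k))
        rw [indicator_of_notMem (by exact hx), hA]
        simp [this]
  have hBint : ∀ k, Integrable (fun x => (inner ℝ (v k) (midCut (ε k) x) : ℝ)) ν := fun k =>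
    (hν.integrable_midCut (hδ.trans_le (hε k))).const_inner _
  have hBint' : Integrable (fun x => Complex.I *
      ((∑ k, inner ℝ (v k) (midCut (ε k) x) : ℝ) : ℂ)) ν :=
    (integrable_finsetSum _ fun k _ => hBint k).ofReal.const_mul _
  have hpt : ∀ x, levyKernel (u + ∑ k, testAbove (ε k) (v k) x) x
      = levyKernel u x + A x - Complex.I * ((∑ k, inner ℝ (v k) (midCut (ε k) x) : ℝ) : ℂ) := by
    intro x
    have e1 : inner ℝ (u + ∑ k, testAbove (ε k) (v k) x) x
        = inner ℝ u x + ∑ k, inner ℝ (v k) (cut (ε k) x) := by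
      rw [inner_add_left, sum_inner]
      congr 1
      refine Finset.sum_congr rfl fun k _ => ?_
      unfold cut testAbove
      split_ifs <;> simp
    have e2 : ∑ k, inner ℝ (v k) (midCut (ε k) x)
        = if ‖x‖ ≤ 1 then ∑ k, inner ℝ (v k) (cut (ε k) x) else 0 := by
      split_ifs with hx
      · refine Finset.sum_congr rfl fun k _ => ?_
        rw [midCut_eq_ite, if_pos hx, cut]
      · refine Finset.sum_eq_zero fun k _ => ?_
        rw [midCut_eq_ite, if_neg hx]; simp
    unfold levyKernel
    rw [e1, e2, hA]
    push_cast
    rw [mul_add, Complex.exp_add]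
    split_ifs <;> push_cast <;> ring
  simp_rw [hpt]
  have hKA : Integrable (fun x => levyKernel u x + A x) ν := (hν.integrable_levyKernel u).add hAint
  rw [integral_sub hKA hBint',
    integral_add (hν.integrable_levyKernel u) hAint, integral_const_mul, integral_complex_ofReal,
    integral_finsetSum _ fun k _ => hBint k]
  simp_rw [fun k => integral_inner (𝕜 := ℝ) (hν.integrable_midCut (hδ.trans_le (hε k))) (v k)]
  rw [levyExponent_eq, hc, inner_add_right, inner_sum]
  simp_rw [real_inner_smul_right, inner_sub_right, real_inner_comm b, ← Finset.mul_sum]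
  rw [Finset.sum_sub_distrib]
  push_cast
  ring

end IsPureJumpLevy

/-! ### Moments and independence of the truncations -/

theorem levyKernel_zero {d : ℕ} (x : E d) : levyKernel 0 x = 0 := by simp [levyKernel]

theorem levyKernel_ite {d : ℕ} (p : E d → Prop) [DecidablePred p] (c x : E d) :
    levyKernel (if p x then c else 0) x = {x | p x}.indicator (levyKernel c) x := by
  by_cases h : p x
  · rw [if_pos h, indicator_of_mem (by exact h)]
  · rw [if_neg h, indicator_of_notMem (by exact h), levyKernel_zero]

/-- The second moment of the Lévy measure on the open ball of radius `ε ≤ 1`. -/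
def smallMass {d : ℕ} (ν : Measure (E d)) (ε : ℝ) : ℝ :=
  ∫ x, {x : E d | ‖x‖ < ε}.indicator (fun x => min (‖x‖ ^ 2) 1) x ∂ν

theorem measurableSet_norm_lt {d : ℕ} (ε : ℝ) : MeasurableSet {x : E d | ‖x‖ < ε} :=
  measurableSet_lt measurable_norm measurable_const

theorem IsLevyMeasure.integrable_indicator_min {d : ℕ} {ν : Measure (E d)} (hν : IsLevyMeasure ν)
    (ε : ℝ) : Integrable ({x : E d | ‖x‖ < ε}.indicator (fun x => min (‖x‖ ^ 2) 1)) ν :=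
  hν.integrable_min.indicator (measurableSet_norm_lt ε)

theorem IsLevyMeasure.tendsto_smallMass {d : ℕ} {ν : Measure (E d)} (hν : IsLevyMeasure ν)
    {δ : ℕ → ℝ} (hδ : Tendsto δ atTop (𝓝 0)) :
    Tendsto (fun j => smallMass ν (δ j)) atTop (𝓝 0) := by
  have := tendsto_integral_of_dominated_convergence (μ := ν)
    (F := fun j => {x : E d | ‖x‖ < δ j}.indicator (fun x => min (‖x‖ ^ 2) 1)) (f := fun _ => 0)
    (fun x => min (‖x‖ ^ 2) 1) (fun j => (hν.integrable_indicator_min _).1) hν.integrable_min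
    (fun j => Eventually.of_forall fun x => ?_) (Eventually.of_forall fun x => ?_)
  · simpa [smallMass] using this
  · refine (norm_indicator_le_norm_self _ _).trans ?_
    rw [Real.norm_of_nonneg (by positivity)]
  · by_cases hx : x = 0
    · subst hx
      refine tendsto_const_nhds.congr fun j => ?_
      simp [indicator_apply]
    · refine tendsto_const_nhds.congr' ?_
      filter_upwards [hδ.eventually_lt_const (norm_pos_iff.2 hx)] with j hj
      rw [indicator_of_notMem (by exact not_lt.2 hj.le)]

namespace IsPureJumpLevy

variable {d : ℕ} {Ω : Type*} [MeasurableSpace Ω] {P : Measure Ω} [IsProbabilityMeasure P]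
  {b : E d} {ν : Measure (E d)} {L : ℝ≥0 → Ω → E d}

/-- A random variable with the compensated characteristic function of the jumps in a set `p` of
small jumps, tested with `θ`, is centred, and its first absolute moment is bounded by the root of
the second moment of `ν` on the ball that contains `p`. -/
theorem moments_of_charFun_eq (hν : IsLevyMeasure ν) {X : Ω → ℝ}
    (hX : AEMeasurable X P) (T : ℝ≥0) (θ : E d) {ε : ℝ} (hε1 : ε ≤ 1) (p : E d → Prop)
    [DecidablePred p] (hp : ∀ x, p x → ‖x‖ < ε)
    (h : ∀ s : ℝ, ∫ ω, Complex.exp (Complex.I * ((s * X ω : ℝ) : ℂ)) ∂P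
      = Complex.exp (((T : ℝ) : ℂ) * ∫ x, levyKernel (if p x then s • θ else 0) x ∂ν)) :
    Integrable X P ∧ ∫ ω, X ω ∂P = 0 ∧
      ∫ ω, |X ω| ∂P ≤ √(4 * T * ‖θ‖ ^ 2 * smallMass ν ε) := by
  have key := moments_of_norm_charFun_sub_one_le hX (C := T * (2 * ‖θ‖ ^ 2 * smallMass ν ε))
    (fun s => ?_)
  · have e : 2 * (T * (2 * ‖θ‖ ^ 2 * smallMass ν ε)) = 4 * T * ‖θ‖ ^ 2 * smallMass ν ε := by ring
    rwa [e] at key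
  · have hre : (((T : ℝ) : ℂ) * ∫ x, levyKernel (if p x then s • θ else 0) x ∂ν).re ≤ 0 := by
      have h1 : ‖∫ ω, Complex.exp (Complex.I * ((s * X ω : ℝ) : ℂ)) ∂P‖ ≤ 1 := by
        refine (norm_integral_le_of_norm_le (integrable_const (1 : ℝ))
          (Eventually.of_forall fun ω => (norm_exp_I_mul _).le)).trans ?_
        simp
      rw [h, Complex.norm_exp, Real.exp_le_one_iff] at h1
      exact h1
    rw [h]
    refine (norm_exp_sub_one_le_of_re_nonpos hre).trans ?_
    rw [norm_mul, Complex.norm_real, Real.norm_of_nonneg T.coe_nonneg, mul_assoc]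
    refine mul_le_mul_of_nonneg_left ?_ T.coe_nonneg
    have e : 2 * ‖θ‖ ^ 2 * smallMass ν ε * s ^ 2
        = ∫ x, (2 * ‖θ‖ ^ 2 * s ^ 2) * {x : E d | ‖x‖ < ε}.indicator
          (fun x => min (‖x‖ ^ 2) 1) x ∂ν := by
      rw [integral_const_mul, smallMass]; ring
    rw [e]
    refine norm_integral_le_of_norm_le ((hν.integrable_indicator_min ε).const_mul _)
      (Eventually.of_forall fun x => ?_)
    by_cases hx : p x
    · have hxε := hp x hx
      rw [if_pos hx, indicator_of_mem (by exact hxε),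
        min_eq_left (by nlinarith [norm_nonneg x]), levyKernel, if_pos (hxε.le.trans hε1)]
      refine (norm_exp_I_mul_sub_one_sub_le _).trans ?_
      have h1 := abs_real_inner_le_norm (s • θ) x
      have h2 : (inner ℝ (s • θ) x : ℝ) ^ 2 ≤ (‖s • θ‖ * ‖x‖) ^ 2 := by
        rw [← sq_abs]; gcongr
      rw [norm_smul, mul_pow, mul_pow, Real.norm_eq_abs, sq_abs] at h2
      linarith
    · rw [if_neg hx, levyKernel_zero, norm_zero]
      exact mul_nonneg (by positivity) (indicator_nonneg (fun x _ => by positivity) x)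

/-- Moments of the remainder `L_T - L^ε_T`. -/
theorem moments_inner_sub_truncated (hL : IsPureJumpLevy P b ν L) (hν : IsLevyMeasure ν)
    (T : ℝ≥0) (θ : E d) {ε : ℝ} (hε : 0 < ε) (hε1 : ε ≤ 1) :
    Integrable (fun ω => inner ℝ θ (L T ω - truncated b ν L ε T ω)) P ∧
      ∫ ω, inner ℝ θ (L T ω - truncated b ν L ε T ω) ∂P = 0 ∧
      ∫ ω, |inner ℝ θ (L T ω - truncated b ν L ε T ω)| ∂P
        ≤ √(4 * T * ‖θ‖ ^ 2 * smallMass ν ε) := by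
  refine moments_of_charFun_eq hν ?_ T θ hε1 (fun x => ‖x‖ < ε) (fun x hx => hx) fun s => ?_
  · exact aemeasurable_const.inner
      ((hL.measurable T).aemeasurable.sub (hL.aemeasurable_truncated hε hε1 T))
  · have := hL.integral_exp_truncated hν T (s • θ) (fun _ : Unit => -(s • θ))
      (ε := fun _ => ε) hε (fun _ => le_rfl) (fun _ => hε1)
    simp only [Finset.univ_unique, Finset.sum_singleton, add_neg_cancel, inner_zero_right,
      Complex.ofReal_zero, mul_zero, zero_add] at this
    convert this using 1
    · refine integral_congr_ae (Eventually.of_forall fun ω => ?_)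
      simp only [inner_sub_right, real_inner_smul_left, inner_neg_left]
      ring_nf
    · congr 2
      refine integral_congr_ae (Eventually.of_forall fun x => ?_)
      rcases lt_or_ge ‖x‖ ε with hx | hx
      · simp [hx, testAbove_of_lt hx]
      · simp [testAbove_of_le hx, not_lt.2 hx]

/-- Moments of the difference of two truncations. -/
theorem moments_inner_truncated_sub_truncated (hL : IsPureJumpLevy P b ν L)
    (hν : IsLevyMeasure ν) (T : ℝ≥0) (θ : E d) {ε ε' : ℝ} (hε' : 0 < ε') (hεε' : ε' ≤ ε)
    (hε1 : ε ≤ 1) :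
    Integrable (fun ω => inner ℝ θ (truncated b ν L ε' T ω - truncated b ν L ε T ω)) P ∧
      ∫ ω, inner ℝ θ (truncated b ν L ε' T ω - truncated b ν L ε T ω) ∂P = 0 ∧
      ∫ ω, |inner ℝ θ (truncated b ν L ε' T ω - truncated b ν L ε T ω)| ∂P
        ≤ √(4 * T * ‖θ‖ ^ 2 * smallMass ν ε) := by
  have hε := hε'.trans_le hεε'
  refine moments_of_charFun_eq hν ?_ T θ hε1 (fun x => ε' ≤ ‖x‖ ∧ ‖x‖ < ε) (fun x hx => hx.2)
    fun s => ?_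
  · exact aemeasurable_const.inner ((hL.aemeasurable_truncated hε' (hεε'.trans hε1) T).sub
      (hL.aemeasurable_truncated hε hε1 T))
  · have := hL.integral_exp_truncated hν T 0 ![s • θ, -(s • θ)]
      (ε := ![ε', ε]) hε' (by simp [Fin.forall_fin_two, hεε'])
      (by simp [Fin.forall_fin_two, hε1, hεε'.trans hε1])
    simp only [Fin.sum_univ_two, Matrix.cons_val_zero, Matrix.cons_val_one, add_neg_cancel,
      inner_zero_right, inner_zero_left, Complex.ofReal_zero, mul_zero, zero_add] at this
    convert this using 1
    · refine integral_congr_ae (Eventually.of_forall fun ω => ?_)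
      simp only [inner_sub_right, real_inner_smul_left, inner_neg_left]
      ring_nf
    · congr 2
      refine integral_congr_ae (Eventually.of_forall fun x => ?_)
      rcases lt_or_ge ‖x‖ ε with hx | hx
      · simp only [testAbove_of_lt (ε := ε) hx]; simp [hx, testAbove]
      · simp [testAbove_of_le hx, not_lt.2 hx, testAbove_of_le (hεε'.trans hx)]

/-- The truncation and the remainder are independent. -/
theorem indepFun_inner_truncated (hL : IsPureJumpLevy P b ν L) (hν : IsLevyMeasure ν)
    (T : ℝ≥0) (θ : E d) {ε : ℝ} (hε : 0 < ε) (hε1 : ε ≤ 1) :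
    IndepFun (fun ω => (inner ℝ θ (truncated b ν L ε T ω) : ℝ))
      (fun ω => (inner ℝ θ (L T ω - truncated b ν L ε T ω) : ℝ)) P := by
  have hm := hL.aemeasurable_truncated hε hε1 T
  set Y : Fin 2 → Ω → ℝ := ![fun ω => (inner ℝ θ (truncated b ν L ε T ω) : ℝ),
    fun ω => (inner ℝ θ (L T ω - truncated b ν L ε T ω) : ℝ)] with hY
  suffices h : iIndepFun Y P from h.indepFun (show (0 : Fin 2) ≠ 1 by decide)
  refine iIndepFun_of_charFun_eq_prod ?_
    ![fun t => Complex.exp (((T : ℝ) : ℂ) * (Complex.I * ((inner ℝ b (t • θ) : ℝ) : ℂ)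
        + ∫ x, levyKernel (if ε ≤ ‖x‖ then t • θ else 0) x ∂ν)),
      fun t => Complex.exp (((T : ℝ) : ℂ)
        * ∫ x, levyKernel (if ‖x‖ < ε then t • θ else 0) x ∂ν)] ?_ fun t => ?_
  · rw [Fin.forall_fin_two]
    exact ⟨aemeasurable_const.inner hm,
      aemeasurable_const.inner ((hL.measurable T).aemeasurable.sub hm)⟩
  · simp [Fin.forall_fin_two, levyKernel_zero]
  · have := hL.integral_exp_truncated hν T (t 1 • θ) (fun _ : Unit => t 0 • θ - t 1 • θ)
      (ε := fun _ => ε) hε (fun _ => le_rfl) (fun _ => hε1)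
    simp only [Finset.univ_unique, Finset.sum_singleton, add_sub_cancel] at this
    simp only [Fin.prod_univ_two, Fin.sum_univ_two, hY, Matrix.cons_val_zero, Matrix.cons_val_one]
    rw [← Complex.exp_add]
    convert this using 1
    · refine integral_congr_ae (Eventually.of_forall fun ω => ?_)
      simp only [inner_sub_right, inner_sub_left, real_inner_smul_left]
      ring_nf
    · rw [← mul_add, add_assoc, ← integral_add]
      · congr 3
        refine integral_congr_ae (Eventually.of_forall fun x => ?_)
        rcases lt_or_ge ‖x‖ ε with hx | hx
        · simp [hx, testAbove_of_lt hx, not_le.2 hx, levyKernel_zero]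
        · simp [hx, testAbove_of_le hx, not_lt.2 hx, levyKernel_zero]
      · simp_rw [levyKernel_ite (fun x => ε ≤ ‖x‖)]
        exact (hν.integrable_levyKernel _).indicator
          (measurableSet_le measurable_const measurable_norm)
      · simp_rw [levyKernel_ite (fun x => ‖x‖ < ε)]
        exact (hν.integrable_levyKernel _).indicator (measurableSet_norm_lt ε)

/-- The truncations at decreasing levels form a process with independent increments. -/
theorem iIndepFun_inner_truncated_sub (hL : IsPureJumpLevy P b ν L) (hν : IsLevyMeasure ν)
    (T : ℝ≥0) (θ : E d) {ε : ℕ → ℝ} (hanti : Antitone ε) (hε : ∀ k, 0 < ε k)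
    (hε1 : ∀ k, ε k ≤ 1) :
    iIndepFun (fun k ω =>
      (inner ℝ θ (truncated b ν L (ε (k + 1)) T ω - truncated b ν L (ε k) T ω) : ℝ)) P := by
  have hm := fun k => hL.aemeasurable_truncated (hε k) (hε1 k) T
  rw [iIndepFun_iff_finset]
  intro s
  refine iIndepFun_of_charFun_eq_prod (fun k => ?_)
    (fun k t => Complex.exp (((T : ℝ) : ℂ) * ∫ x,
      levyKernel (if ε (k + 1) ≤ ‖x‖ ∧ ‖x‖ < ε k then t • θ else 0) x ∂ν)) (fun k => ?_)
    fun t => ?_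
  · exact aemeasurable_const.inner ((hm _).sub (hm _))
  · simp [levyKernel_zero]
  · obtain ⟨N, hN⟩ : ∃ N, ∀ k ∈ s, k < N := ⟨s.sup id + 1, fun k hk =>
      Nat.lt_succ_of_le (Finset.le_sup (f := id) hk)⟩
    have := hL.integral_exp_truncated hν T 0
      (Sum.elim (fun k : s => t k • θ) fun k : s => -(t k • θ))
      (ε := Sum.elim (fun k : s => ε (k + 1)) fun k : s => ε k) (hε N)
      (by
        rintro (k | k)
        · exact hanti (hN k k.2)
        · exact hanti (hN k k.2).le)
      (by rintro (k | k) <;> exact hε1 _)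
    simp only [Fintype.sum_sum_type, Sum.elim_inl, Sum.elim_inr, Finset.sum_neg_distrib,
      add_neg_cancel, inner_zero_right, inner_zero_left, Complex.ofReal_zero, mul_zero, zero_add,
      ← Finset.sum_add_distrib] at this
    convert this using 1
    · refine integral_congr_ae (Eventually.of_forall fun ω => ?_)
      simp only [inner_sub_right, real_inner_smul_left, inner_neg_left, Finset.restrict]
      congr 3
      refine Finset.sum_congr rfl fun k _ => ?_
      ring
    · rw [← Complex.exp_sum, ← Finset.mul_sum, ← integral_finsetSum]
      · congr 2
        refine integral_congr_ae (Eventually.of_forall fun x => ?_)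
        have hite : ∀ k : s, testAbove (ε (k + 1)) (t k • θ) x
            + testAbove (ε k) (-(t k • θ)) x
            = if ε (k + 1) ≤ ‖x‖ ∧ ‖x‖ < ε k then t k • θ else 0 := by
          intro k
          rcases lt_or_ge ‖x‖ (ε k) with hx | hx
          · simp [hx, testAbove]
          · simp [not_lt.2 hx, testAbove_of_le hx,
              testAbove_of_le ((hanti (Nat.le_succ k)).trans hx)]
        simp only [hite]
        by_cases hk : ∃ k : s, ε (k + 1) ≤ ‖x‖ ∧ ‖x‖ < ε k
        · obtain ⟨k, hk⟩ := hk
          have hne : ∀ j : s, j ≠ k → ¬ (ε (j + 1) ≤ ‖x‖ ∧ ‖x‖ < ε j) := by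
            rintro j hj ⟨h1, h2⟩
            rcases lt_or_gt_of_ne (fun h => hj (Subtype.ext h) : (j : ℕ) ≠ k) with hlt | hlt
            · exact absurd (h1.trans_lt hk.2) (not_lt.2 (hanti hlt))
            · exact absurd (hk.1.trans_lt h2) (not_lt.2 (hanti hlt))
          rw [Finset.sum_eq_single k (fun j _ hj => by rw [if_neg (hne j hj), levyKernel_zero])
              (by simp),
            Finset.sum_eq_single k (fun j _ hj => by rw [if_neg (hne j hj)]) (by simp)]
        · have hne : ∀ j : s, ¬ (ε (j + 1) ≤ ‖x‖ ∧ ‖x‖ < ε j) := fun j hj => hk ⟨j, hj⟩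
          simp [hne, levyKernel_zero]
      · intro k _
        simp_rw [levyKernel_ite (fun x => ε (k + 1) ≤ ‖x‖ ∧ ‖x‖ < ε k)]
        exact (hν.integrable_levyKernel _).indicator
          ((measurableSet_le measurable_const measurable_norm).inter (measurableSet_norm_lt _))

end IsPureJumpLevy

/-! ### Almost sure convergence of the truncations -/

theorem norm_le_sum_abs {d : ℕ} (x : E d) : ‖x‖ ≤ ∑ i, |x i| := by
  rw [EuclideanSpace.norm_eq]
  refine Real.sqrt_le_iff.2 ⟨Finset.sum_nonneg fun i _ => abs_nonneg _, ?_⟩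
  exact Finset.sum_sq_le_sq_sum_of_nonneg fun i _ => abs_nonneg _

theorem inner_single_one {d : ℕ} (i : Fin d) (x : E d) :
    (inner ℝ (EuclideanSpace.single i (1 : ℝ)) x : ℝ) = x i := by
  simp [EuclideanSpace.inner_single_left]

namespace IsPureJumpLevy

variable {d : ℕ} {Ω : Type*} [MeasurableSpace Ω] {P : Measure Ω} [IsProbabilityMeasure P]
  {b : E d} {ν : Measure (E d)} {L : ℝ≥0 → Ω → E d}

/-- Doob's maximal inequality for the truncations at all levels in `(0, δ]`. It is applied to
levels in a finite grid; left-continuity in the level gives all levels. -/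
theorem mul_measure_exists_truncated_sub_le (hL : IsPureJumpLevy P b ν L) (hν : IsLevyMeasure ν)
    (T : ℝ≥0) (θ : E d) {δ : ℝ} (hδ : 0 < δ) (hδ1 : δ ≤ 1) (a : ℝ≥0) :
    a * P {ω | IsCadlag (fun t => L t ω) ∧ ∃ ε, 0 < ε ∧ ε ≤ δ ∧
        (a : ℝ) < |inner ℝ θ (truncated b ν L ε T ω - truncated b ν L δ T ω)|}
      ≤ ENNReal.ofReal √(4 * T * ‖θ‖ ^ 2 * smallMass ν δ) := by
  set c := ENNReal.ofReal √(4 * T * ‖θ‖ ^ 2 * smallMass ν δ)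
  set Z : ℝ → Ω → ℝ := fun ε ω => inner ℝ θ (truncated b ν L ε T ω - truncated b ν L δ T ω) with hZ
  -- the level `lev n k` is `δ (1 - k / (n + 1))` for `k ≤ n`, and constant in `k` from `k = n` on
  set lev : ℕ → ℕ → ℝ := fun n k => δ * (1 - (min k n : ℕ) / ((n : ℝ) + 1)) with hlev
  set bad : ℕ → Set Ω := fun n => {ω | ∃ k ≤ n, (a : ℝ) ≤ |Z (lev n (k + 1)) ω|} with hbad
  have hlev0 : ∀ n, lev n 0 = δ := fun n => by simp [hlev]
  have hlevpos : ∀ n k, 0 < lev n k := fun n k => by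
    refine mul_pos hδ (sub_pos.2 ?_)
    rw [div_lt_one (by positivity)]
    have : ((min k n : ℕ) : ℝ) ≤ n := by exact_mod_cast min_le_right k n
    linarith
  have hanti : ∀ n, Antitone (lev n) := fun n i j hij => by
    simp only [hlev]
    gcongr
  have hlev1 : ∀ n k, lev n k ≤ 1 := fun n k =>
    ((hanti n (Nat.zero_le k)).trans_eq (hlev0 n)).trans hδ1
  have hbadle : ∀ n, a * P (bad n) ≤ c := by
    intro n
    have hsum : ∀ k ω, ∑ j ∈ Finset.range (k + 1), (inner ℝ θ (truncated b ν L (lev n (j + 1)) T ω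
        - truncated b ν L (lev n j) T ω) : ℝ) = Z (lev n (k + 1)) ω := by
      intro k ω
      rw [← inner_sum, Finset.sum_range_sub (fun j => truncated b ν L (lev n j) T ω), hlev0]
    have := mul_measure_le_of_iIndepFun (P := P)
      (fun k => (hL.moments_inner_truncated_sub_truncated hν T θ (hlevpos n (k + 1))
        (hanti n (Nat.le_succ k)) (hlev1 n k)).1)
      (hL.iIndepFun_inner_truncated_sub hν T θ (hanti n) (hlevpos n) (hlev1 n))
      (fun k => (hL.moments_inner_truncated_sub_truncated hν T θ (hlevpos n (k + 1))
        (hanti n (Nat.le_succ k)) (hlev1 n k)).2.1) a n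
    simp_rw [hsum] at this
    refine this.trans (ENNReal.ofReal_le_ofReal ?_)
    exact (hL.moments_inner_truncated_sub_truncated hν T θ (hlevpos n (n + 1))
        ((hanti n (Nat.zero_le _)).trans_eq (hlev0 n)) hδ1).2.2
  have hsub : {ω | IsCadlag (fun t => L t ω) ∧ ∃ ε, 0 < ε ∧ ε ≤ δ ∧ (a : ℝ) < |Z ε ω|}
      ⊆ ⋃ N, ⋂ n, ⋂ (_ : N ≤ n), bad n := by
    rintro ω ⟨hω, ε, hε, hεδ, hlt⟩
    have hεlt : ε < δ := lt_of_le_of_ne hεδ fun h => by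
      subst h
      simp only [hZ, sub_self, inner_zero_right, abs_zero] at hlt
      exact absurd hlt (not_lt.2 a.coe_nonneg)
    set r : ℝ := 1 - ε / δ with hr
    have hr0 : 0 < r := sub_pos.2 ((div_lt_one hδ).2 hεlt)
    have hr1 : r < 1 := sub_lt_self _ (div_pos hε hδ)
    -- the grid levels with index `J n` lie below `ε` and converge to it; since `r < 1`, they
    -- do belong to the grid for large `n`
    set J : ℕ → ℕ := fun n => ⌈r * ((n + 1 : ℕ) : ℝ)⌉₊ with hJ
    have hJlim : Tendsto (fun n : ℕ => (J n : ℝ) / ((n : ℝ) + 1)) atTop (𝓝 r) := by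
      have := (tendsto_nat_ceil_mul_div_atTop hr0.le).comp
        ((tendsto_natCast_atTop_atTop (R := ℝ)).comp (tendsto_add_atTop_nat 1))
      refine this.congr fun n => ?_
      simp [hJ]
    have hlim : Tendsto (fun n : ℕ => δ * (1 - (J n : ℝ) / ((n : ℝ) + 1))) atTop (𝓝[≤] ε) := by
      refine tendsto_nhdsWithin_iff.2 ⟨?_, Eventually.of_forall fun n => ?_⟩
      · have := (hJlim.const_sub 1).const_mul δ
        have e : δ * (1 - r) = ε := by rw [hr]; field_simp; ring
        rwa [e] at this
      · have h1 : r ≤ (J n : ℝ) / ((n : ℝ) + 1) := by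
          rw [le_div_iff₀ (by positivity)]
          exact_mod_cast Nat.le_ceil (r * ((n + 1 : ℕ) : ℝ))
        have e : ε = δ * (1 - r) := by rw [hr]; field_simp; ring
        rw [mem_Iic, e]
        gcongr
    have hZlim := (tendsto_truncated_nhdsLE (b := b) hν hω hε (hεδ.trans hδ1) T).comp hlim
    have hZlim2 := ((tendsto_const_nhds (x := θ)).inner
      (hZlim.sub_const (truncated b ν L δ T ω)) (𝕜 := ℝ)).abs
    have hev : ∀ᶠ n in atTop, ω ∈ bad n := by
      filter_upwards [hZlim2.eventually (lt_mem_nhds hlt), hJlim.eventually_lt_const hr1]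
        with n hn hJn
      rw [div_lt_one (by positivity)] at hJn
      have hJn' : J n ≤ n := Nat.lt_succ_iff.1 (by exact_mod_cast hJn)
      have hJpos : 0 < J n := Nat.ceil_pos.2 (by positivity)
      refine ⟨J n - 1, (Nat.sub_le _ _).trans hJn', ?_⟩
      have e : lev n (J n - 1 + 1) = δ * (1 - (J n : ℝ) / ((n : ℝ) + 1)) := by
        simp only [hlev]
        rw [Nat.sub_add_cancel hJpos, min_eq_left hJn']
      rw [e]
      exact hn.le
    obtain ⟨N, hN⟩ := eventually_atTop.1 hev
    exact mem_iUnion.2 ⟨N, mem_iInter₂.2 hN⟩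
  have hmono : Monotone fun N => ⋂ n, ⋂ (_ : N ≤ n), bad n := fun N M hNM ω hω =>
    mem_iInter₂.2 fun n hn => mem_iInter₂.1 hω n (hNM.trans hn)
  calc a * P {ω | IsCadlag (fun t => L t ω) ∧ ∃ ε, 0 < ε ∧ ε ≤ δ ∧ (a : ℝ) < |Z ε ω|}
      ≤ a * P (⋃ N, ⋂ n, ⋂ (_ : N ≤ n), bad n) := by gcongr
    _ = ⨆ N, a * P (⋂ n, ⋂ (_ : N ≤ n), bad n) := by rw [hmono.measure_iUnion, ENNReal.mul_iSup]
    _ ≤ c := iSup_le fun N => (mul_le_mul_right (measure_mono (iInter₂_subset N le_rfl)) _).trans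
      (hbadle N)

/-- Almost surely the remainder is small for all small levels. The exceptional set at level `δ j`
is controlled by Doob's inequality for the truncations below `δ j` and by Markov's inequality for
the remainder at `δ j`, and both bounds tend to `0` as the level does. -/
theorem ae_exists_abs_inner_sub_truncated_le (hL : IsPureJumpLevy P b ν L) (hν : IsLevyMeasure ν)
    (T : ℝ≥0) (θ : E d) {a : ℝ≥0} (ha : 0 < a) :
    ∀ᵐ ω ∂P, ∃ δ > 0, ∀ ε, 0 < ε → ε ≤ δ →
      |inner ℝ θ (L T ω - truncated b ν L ε T ω)| ≤ 2 * (a : ℝ) := by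
  set δ : ℕ → ℝ := fun j => 1 / ((j : ℝ) + 1) with hδdef
  have hδ : ∀ j, 0 < δ j := fun j => by positivity
  have hδ1 : ∀ j, δ j ≤ 1 := fun j => by
    rw [hδdef, div_le_one (by positivity)]; linarith [(Nat.cast_nonneg j : (0 : ℝ) ≤ j)]
  set A : ℕ → Set Ω := fun j => {ω | IsCadlag (fun t => L t ω) ∧ ∃ ε, 0 < ε ∧ ε ≤ δ j ∧
        (a : ℝ) < |inner ℝ θ (truncated b ν L ε T ω - truncated b ν L (δ j) T ω)|}
  set B : ℕ → Set Ω := fun j => {ω | (a : ℝ≥0∞) ≤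
    ENNReal.ofReal |inner ℝ θ (L T ω - truncated b ν L (δ j) T ω)|}
  set c : ℕ → ℝ≥0∞ := fun j => ENNReal.ofReal √(4 * T * ‖θ‖ ^ 2 * smallMass ν (δ j))
  have hA : ∀ j, a * P (A j) ≤ c j := fun j =>
    hL.mul_measure_exists_truncated_sub_le hν T θ (hδ j) (hδ1 j) a
  have hB : ∀ j, a * P (B j) ≤ c j := fun j => by
    obtain ⟨h1, -, h2⟩ := hL.moments_inner_sub_truncated hν T θ (hδ j) (hδ1 j)
    refine (mul_meas_ge_le_lintegral₀ (h1.abs.aemeasurable.ennreal_ofReal) _).trans ?_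
    rw [← ofReal_integral_eq_lintegral_ofReal h1.abs (Eventually.of_forall fun ω => abs_nonneg _)]
    exact ENNReal.ofReal_le_ofReal h2
  have hc : Tendsto (fun j => c j + c j) atTop (𝓝 0) := by
    have h1 := (hν.tendsto_smallMass (δ := δ) tendsto_one_div_add_atTop_nhds_zero_nat).const_mul
      (4 * T * ‖θ‖ ^ 2)
    have h2 : Tendsto c atTop (𝓝 0) := by
      have := (ENNReal.continuous_ofReal.comp Real.continuous_sqrt).tendsto 0 |>.comp
        (by simpa using h1)
      rwa [Function.comp_apply, Real.sqrt_zero, ENNReal.ofReal_zero] at this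
    simpa using h2.add h2
  have hzero : P (⋂ j, (A j ∪ B j)) = 0 := by
    have : ∀ j, a * P (⋂ j, (A j ∪ B j)) ≤ c j + c j := fun j =>
      calc a * P (⋂ j, (A j ∪ B j)) ≤ a * (P (A j) + P (B j)) := by
            gcongr
            exact (measure_mono (iInter_subset _ j)).trans (measure_union_le _ _)
        _ = a * P (A j) + a * P (B j) := mul_add _ _ _
        _ ≤ c j + c j := add_le_add (hA j) (hB j)
    have h0 := ge_of_tendsto' hc this
    rw [nonpos_iff_eq_zero, mul_eq_zero] at h0
    exact h0.resolve_left (by exact_mod_cast ha.ne')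
  have hae : ∀ᵐ ω ∂P, ω ∉ ⋂ j, (A j ∪ B j) := measure_eq_zero_iff_ae_notMem.1 hzero
  filter_upwards [hae, hL.cadlag] with ω hω hcad
  obtain ⟨j, hj⟩ := by simpa only [mem_iInter, not_forall] using hω
  rw [mem_union, not_or] at hj
  refine ⟨δ j, hδ j, fun ε hε hεδ => ?_⟩
  have h1 : |inner ℝ θ (truncated b ν L ε T ω - truncated b ν L (δ j) T ω)| ≤ (a : ℝ) :=
    not_lt.1 fun h => hj.1 ⟨hcad, ε, hε, hεδ, h⟩
  have h2 : |inner ℝ θ (L T ω - truncated b ν L (δ j) T ω)| < (a : ℝ) := by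
    refine not_le.1 fun h => hj.2 ?_
    change (a : ℝ≥0∞) ≤ _
    rw [← ENNReal.ofReal_coe_nnreal]
    exact ENNReal.ofReal_le_ofReal h
  have e : (inner ℝ θ (L T ω - truncated b ν L ε T ω) : ℝ)
      = inner ℝ θ (L T ω - truncated b ν L (δ j) T ω)
        - inner ℝ θ (truncated b ν L ε T ω - truncated b ν L (δ j) T ω) := by
    rw [← inner_sub_right, sub_sub_sub_cancel_right]
  rw [e]
  exact (abs_sub _ _).trans (by linarith)

/-- The Lévy–Itô decomposition: almost surely the truncated values converge to `L_T` as the level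
tends to `0` through all positive reals. -/
theorem ae_tendsto_truncated (hL : IsPureJumpLevy P b ν L) (hν : IsLevyMeasure ν) (T : ℝ≥0) :
    ∀ᵐ ω ∂P, Tendsto (fun ε => truncated b ν L ε T ω) (𝓝[>] 0) (𝓝 (L T ω)) := by
  have hall : ∀ᵐ ω ∂P, ∀ (i : Fin d) (m : ℕ), ∃ δ > 0, ∀ ε, 0 < ε → ε ≤ δ →
      |inner ℝ (EuclideanSpace.single i (1 : ℝ)) (L T ω - truncated b ν L ε T ω)|
        ≤ 2 * ((1 / ((m : ℝ≥0) + 1) : ℝ≥0) : ℝ) :=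
    ae_all_iff.2 fun i => ae_all_iff.2 fun m =>
      hL.ae_exists_abs_inner_sub_truncated_le hν T _ (by positivity)
  filter_upwards [hall] with ω hω
  rw [tendsto_iff_norm_sub_tendsto_zero]
  have hcoord : ∀ i : Fin d, Tendsto (fun ε => |(truncated b ν L ε T ω - L T ω) i|) (𝓝[>] 0)
      (𝓝 0) := by
    intro i
    rw [Metric.tendsto_nhds]
    intro η hη
    obtain ⟨m, hm⟩ := exists_nat_one_div_lt (half_pos hη)
    obtain ⟨δ, hδ, h⟩ := hω i m
    filter_upwards [Ioc_mem_nhdsGT hδ] with ε hε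
    have := h ε hε.1 hε.2
    rw [inner_single_one, ← neg_sub, PiLp.neg_apply, abs_neg] at this
    rw [Real.dist_eq, sub_zero, abs_abs]
    push_cast at this
    linarith
  have hsum := tendsto_finsetSum Finset.univ fun i _ => hcoord i
  rw [Finset.sum_const_zero] at hsum
  exact squeeze_zero (fun _ => norm_nonneg _) (fun _ => norm_le_sum_abs _) hsum

end IsPureJumpLevy

/-! ### Convergence of cumulant functions and their gradients -/

/-- Dominated convergence with dominating functions that may vary but whose integrals converge. -/
theorem tendsto_integral_of_tendsto_integral_bound {Ω : Type*} [MeasurableSpace Ω] {P : Measure Ω}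
    [IsProbabilityMeasure P] {V : Type*} [NormedAddCommGroup V] [NormedSpace ℝ V]
    {F : ℕ → Ω → V} {F' : Ω → V} {G : ℕ → Ω → ℝ} {G' : Ω → ℝ}
    (hF : ∀ j, AEStronglyMeasurable (F j) P) (hle : ∀ j, ∀ᵐ ω ∂P, ‖F j ω‖ ≤ G j ω)
    (hlim : ∀ᵐ ω ∂P, Tendsto (fun j => F j ω) atTop (𝓝 (F' ω)))
    (hGlim : ∀ᵐ ω ∂P, Tendsto (fun j => G j ω) atTop (𝓝 (G' ω)))
    (hG : ∀ j, Integrable (G j) P) (hG' : Integrable G' P)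
    (hint : Tendsto (fun j => ∫ ω, G j ω ∂P) atTop (𝓝 (∫ ω, G' ω ∂P))) :
    Tendsto (fun j => ∫ ω, F j ω ∂P) atTop (𝓝 (∫ ω, F' ω ∂P)) := by
  have hFi : ∀ j, Integrable (F j) P := fun j => (hG j).mono' (hF j) (hle j)
  have hall : ∀ᵐ ω ∂P, ∀ j, ‖F j ω‖ ≤ G j ω := ae_all_iff.2 hle
  have hle' : ∀ᵐ ω ∂P, ‖F' ω‖ ≤ G' ω := by
    filter_upwards [hall, hlim, hGlim] with ω h1 h2 h3
    exact le_of_tendsto_of_tendsto' h2.norm h3 h1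
  have hFi' : Integrable F' P :=
    hG'.mono' (aestronglyMeasurable_of_tendsto_ae _ hF hlim) hle'
  set a : ℕ → ℝ := fun j => ∫ ω, ‖F j ω - F' ω‖ ∂P with ha
  -- Fatou applied to `H`; the constant `1` makes the limit of the integrals positive, as needed for
  -- strict inequalities between values of `ENNReal.ofReal`
  set H : ℕ → Ω → ℝ := fun j ω => G j ω + G' ω + 1 - ‖F j ω - F' ω‖ with hH
  have hd : ∀ j, Integrable (fun ω => ‖F j ω - F' ω‖) P := fun j => ((hFi j).sub hFi').norm
  have hs : ∀ j, Integrable (fun ω => G j ω + G' ω + 1) P := fun j =>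
    ((hG j).add hG').add (integrable_const 1)
  have hHi : ∀ j, Integrable (H j) P := fun j => (hs j).sub (hd j)
  have hH0 : ∀ j, 0 ≤ᵐ[P] H j := fun j => by
    filter_upwards [hall, hle'] with ω h1 h2
    have := norm_sub_le (F j ω) (F' ω)
    simp only [hH, Pi.zero_apply]
    linarith [h1 j]
  have hHint : ∀ j, ∫ ω, H j ω ∂P = ∫ ω, G j ω ∂P + ∫ ω, G' ω ∂P + 1 - a j := fun j => by
    have hs' : Integrable (fun ω => G j ω + G' ω) P := (hG j).add hG'
    simp only [hH]
    rw [integral_sub (hs j) (hd j), integral_add hs' (integrable_const 1),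
      integral_add (hG j) hG']
    simp [ha]
  set g := ∫ ω, G' ω ∂P
  have hg : 0 ≤ g := integral_nonneg_of_ae (by
    filter_upwards [hle'] with ω h using (norm_nonneg _).trans h)
  have hfatou : ENNReal.ofReal (2 * g + 1)
      ≤ liminf (fun j => ENNReal.ofReal (∫ ω, G j ω ∂P + g + 1 - a j)) atTop := by
    have e1 : ∫ ω, (2 * G' ω + 1) ∂P = 2 * g + 1 := by
      rw [integral_add (hG'.const_mul 2) (integrable_const 1), integral_const_mul]; simp [g]
    have h2 : Integrable (fun ω => 2 * G' ω + 1) P := (hG'.const_mul 2).add (integrable_const 1)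
    rw [← e1, ofReal_integral_eq_lintegral_ofReal h2 (by
      filter_upwards [hle'] with ω h
      simp only [Pi.zero_apply]
      linarith [(norm_nonneg _).trans h])]
    have e2 : ∀ j, ENNReal.ofReal (∫ ω, G j ω ∂P + g + 1 - a j)
        = ∫⁻ ω, ENNReal.ofReal (H j ω) ∂P := fun j => by
      rw [← ofReal_integral_eq_lintegral_ofReal (hHi j) (hH0 j), hHint]
    simp_rw [e2]
    refine le_trans (lintegral_mono_ae ?_) (lintegral_liminf_le' (u := atTop)
      fun j => (hHi j).aemeasurable.ennreal_ofReal)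
    filter_upwards [hlim, hGlim] with ω h1 h2
    have h3 : Tendsto (fun j => H j ω) atTop (𝓝 (2 * G' ω + 1)) := by
      have := ((h2.add_const (G' ω)).add_const 1).sub (h1.sub_const (F' ω)).norm
      rw [sub_self, norm_zero, sub_zero, ← two_mul] at this
      exact this
    exact ((ENNReal.continuous_ofReal.tendsto _).comp h3).liminf_eq.ge
  have ha0 : Tendsto a atTop (𝓝 0) := by
    rw [Metric.tendsto_nhds]
    intro η hη
    have hlt : ENNReal.ofReal (2 * g + 1 - η / 2) < ENNReal.ofReal (2 * g + 1) :=
      (ENNReal.ofReal_lt_ofReal_iff (by positivity)).2 (by linarith)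
    have hev := eventually_lt_of_lt_liminf (hlt.trans_le hfatou)
    filter_upwards [hev, hint.eventually_lt_const (show g < g + η / 2 by linarith)] with j h1 h2
    have h3 := (ENNReal.ofReal_lt_ofReal_iff'.1 h1).1
    have h4 : 0 ≤ a j := integral_nonneg fun ω => norm_nonneg _
    rw [Real.dist_eq, sub_zero, abs_of_nonneg h4]
    linarith
  rw [tendsto_iff_norm_sub_tendsto_zero]
  refine squeeze_zero (fun _ => norm_nonneg _) (fun j => ?_) ha0
  rw [← integral_sub (hFi j) hFi']
  exact norm_integral_le_integral_norm _

theorem ofReal_integral_le_lintegral_ofReal {Ω : Type*} [MeasurableSpace Ω] {P : Measure Ω}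
    {f : Ω → ℝ} (hf : Integrable f P) :
    ENNReal.ofReal (∫ ω, f ω ∂P) ≤ ∫⁻ ω, ENNReal.ofReal (f ω) ∂P := by
  have h1 : ∫ ω, f ω ∂P ≤ ∫ ω, max (f ω) 0 ∂P :=
    integral_mono hf hf.pos_part fun ω => le_max_left _ _
  refine (ENNReal.ofReal_le_ofReal h1).trans_eq ?_
  rw [ofReal_integral_eq_lintegral_ofReal hf.pos_part
    (Eventually.of_forall fun ω => le_max_right _ _)]
  simp

/-- Finitely many vectors of norm at most `ρ` such that every `x` has a large inner product with
one of them. -/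
theorem exists_inner_ge {d : ℕ} {ρ : ℝ} (hρ : 0 < ρ) :
    ∃ q : Option (Fin d × Bool) → E d, (∀ k, ‖q k‖ ≤ ρ) ∧
      ∀ x : E d, ∃ k, ρ / (d + 1) * ‖x‖ ≤ inner ℝ (q k) x := by
  refine ⟨fun k => k.elim 0 fun p => (if p.2 then ρ else -ρ) • EuclideanSpace.single p.1 (1 : ℝ),
    ?_, fun x => ?_⟩
  · rintro (_ | ⟨i, _ | _⟩) <;> simp [norm_smul, hρ.le, abs_of_pos hρ]
  · rcases isEmpty_or_nonempty (Fin d) with hd | hd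
    · refine ⟨none, ?_⟩
      have : x = 0 := by ext i; exact hd.elim i
      simp [this]
    · obtain ⟨i, -, hi⟩ := Finset.exists_max_image Finset.univ (fun i => |x i|)
        Finset.univ_nonempty
      have h1 : ‖x‖ ≤ d * |x i| := (norm_le_sum_abs x).trans (by
        simpa using Finset.sum_le_card_nsmul Finset.univ (fun j => |x j|) _
          fun j hj => hi j hj)
      have h2 : ρ / (d + 1) * ‖x‖ ≤ ρ * |x i| := by
        rw [div_mul_eq_mul_div, div_le_iff₀ (by positivity), mul_assoc]
        refine mul_le_mul_of_nonneg_left ?_ hρ.le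
        linarith [abs_nonneg (x i)]
      rcases le_total 0 (x i) with h | h
      · refine ⟨some (i, true), h2.trans_eq ?_⟩
        simp [real_inner_smul_left, inner_single_one, abs_of_nonneg h]
      · refine ⟨some (i, false), h2.trans_eq ?_⟩
        simp [real_inner_smul_left, inner_single_one, abs_of_nonpos h]

/-- Near a point of an open set `U`, exponentials and their first derivatives are dominated by a
finite sum of exponentials with parameters in `U`. -/
theorem exists_exp_inner_bound {d : ℕ} {U : Set (E d)} (hU : IsOpen U) {θ₀ : E d} (hθ : θ₀ ∈ U) :
    ∃ r > 0, ∃ C, ∃ p : Option (Fin d × Bool) → E d, (∀ k, p k ∈ U) ∧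
      ∀ θ ∈ Metric.ball θ₀ r, ∀ x : E d, Real.exp (inner ℝ θ x) * (1 + ‖x‖)
        ≤ C * ∑ k, Real.exp (inner ℝ (p k) x) := by
  obtain ⟨ρ, hρ, hball⟩ := Metric.nhds_basis_closedBall.mem_iff.1 (hU.mem_nhds hθ)
  obtain ⟨q, hq, hqx⟩ := exists_inner_ge (d := d) hρ
  set r := ρ / (d + 1) / 2 with hr
  have hr0 : 0 < r := by positivity
  refine ⟨r, hr0, 1 + 1 / r, fun k => θ₀ + q k, fun k => hball ?_, fun θ hθ x => ?_⟩
  · simpa using hq k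
  · obtain ⟨k, hk⟩ := hqx x
    have h1 : inner ℝ θ x ≤ inner ℝ θ₀ x + r * ‖x‖ := by
      have h2 : inner ℝ (θ - θ₀) x ≤ ‖θ - θ₀‖ * ‖x‖ := real_inner_le_norm _ _
      rw [inner_sub_left] at h2
      have h3 : ‖θ - θ₀‖ * ‖x‖ ≤ r * ‖x‖ := by
        rw [← dist_eq_norm]
        gcongr
        exact (Metric.mem_ball.1 hθ).le
      linarith
    have h2 : 1 + ‖x‖ ≤ (1 + 1 / r) * Real.exp (r * ‖x‖) := by
      have h3 := Real.add_one_le_exp (r * ‖x‖)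
      have h4 : (1 + 1 / r) * (r * ‖x‖ + 1) ≤ (1 + 1 / r) * Real.exp (r * ‖x‖) := by gcongr
      have h5 : (1 + 1 / r) * (r * ‖x‖ + 1) = 1 + ‖x‖ + (r * ‖x‖ + 1 / r) := by
        field_simp; ring
      have h6 : 0 ≤ r * ‖x‖ + 1 / r := by positivity
      linarith
    have h3 : Real.exp (inner ℝ (θ₀ + q k) x) ≤ ∑ k, Real.exp (inner ℝ (θ₀ + q k) x) :=
      Finset.single_le_sum (f := fun k => Real.exp (inner ℝ (θ₀ + q k) x))
        (fun k _ => (Real.exp_pos _).le) (Finset.mem_univ k)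
    calc Real.exp (inner ℝ θ x) * (1 + ‖x‖)
        ≤ Real.exp (inner ℝ θ₀ x + r * ‖x‖) * ((1 + 1 / r) * Real.exp (r * ‖x‖)) := by gcongr
      _ = (1 + 1 / r) * Real.exp (inner ℝ θ₀ x + ρ / (d + 1) * ‖x‖) := by
          rw [mul_left_comm, ← Real.exp_add, hr]; ring_nf
      _ ≤ (1 + 1 / r) * Real.exp (inner ℝ (θ₀ + q k) x) := by
          rw [inner_add_left]; gcongr
      _ ≤ _ := by gcongr

section Cumulant

variable {d : ℕ} {Ω : Type*} [MeasurableSpace Ω] {P : Measure Ω}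

/-- Differentiation of a moment generating function under the integral, in the interior of the
domain where it is finite. -/
theorem hasGradientAt_integral_exp {Y : Ω → E d} (hY : AEMeasurable Y P) {U : Set (E d)}
    (hU : IsOpen U) (hint : ∀ θ ∈ U, Integrable (fun ω => Real.exp (inner ℝ θ (Y ω))) P)
    {θ₀ : E d} (hθ : θ₀ ∈ U) :
    HasGradientAt (fun θ => ∫ ω, Real.exp (inner ℝ θ (Y ω)) ∂P)
      (∫ ω, Real.exp (inner ℝ θ₀ (Y ω)) • Y ω ∂P) θ₀ := by
  obtain ⟨r, hr, C, p, hp, hb⟩ := exists_exp_inner_bound hU hθ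
  have hbound : Integrable (fun ω => C * ∑ k, Real.exp (inner ℝ (p k) (Y ω))) P :=
    (integrable_finsetSum _ fun k _ => hint _ (hp k)).const_mul _
  have hmeas : ∀ θ : E d, AEStronglyMeasurable (fun ω => Real.exp (inner ℝ θ (Y ω))) P := fun θ =>
    (Real.measurable_exp.comp_aemeasurable (aemeasurable_const.inner hY)).aestronglyMeasurable
  have hnorm : ∀ θ ∈ Metric.ball θ₀ r, ∀ ω, ‖Real.exp (inner ℝ θ (Y ω)) • Y ω‖
      ≤ C * ∑ k, Real.exp (inner ℝ (p k) (Y ω)) := fun θ hθ ω => by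
    rw [norm_smul, Real.norm_of_nonneg (Real.exp_pos _).le]
    refine le_trans ?_ (hb θ hθ (Y ω))
    gcongr
    linarith
  have hYint : Integrable (fun ω => Real.exp (inner ℝ θ₀ (Y ω)) • Y ω) P :=
    hbound.mono' ((hmeas θ₀).smul hY.aestronglyMeasurable)
      (Eventually.of_forall fun ω => hnorm θ₀ (Metric.mem_ball_self hr) ω)
  have key := hasFDerivAt_integral_of_dominated_of_fderiv_le (μ := P)
    (F := fun θ ω => Real.exp (inner ℝ θ (Y ω)))
    (F' := fun θ ω => Real.exp (inner ℝ θ (Y ω)) • innerSL ℝ (Y ω)) (x₀ := θ₀)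
    (bound := fun ω => C * ∑ k, Real.exp (inner ℝ (p k) (Y ω))) (Metric.ball_mem_nhds θ₀ hr)
    (Eventually.of_forall hmeas) (hint θ₀ hθ) ?_ (Eventually.of_forall fun ω θ hθ => ?_) hbound
    (Eventually.of_forall fun ω θ hθ => ?_)
  · have h1 := (innerSL ℝ (E := E d)).integral_comp_comm hYint
    have h2 : InnerProductSpace.toDual ℝ (E d) (∫ ω, Real.exp (inner ℝ θ₀ (Y ω)) • Y ω ∂P)
        = ∫ ω, Real.exp (inner ℝ θ₀ (Y ω)) • innerSL ℝ (Y ω) ∂P := by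
      simp_rw [map_smul] at h1
      rw [h1]
      rfl
    rw [hasGradientAt_iff_hasFDerivAt, h2]
    exact key
  · exact (hmeas θ₀).smul ((innerSL ℝ).continuous.measurable.comp_aemeasurable
      hY).aestronglyMeasurable
  · refine le_trans (le_of_eq ?_) (hnorm θ hθ ω)
    rw [norm_smul, norm_smul, innerSL_apply_norm]
  · have h1 : HasFDerivAt (fun θ : E d => (inner ℝ θ (Y ω) : ℝ)) (innerSL ℝ (Y ω)) θ := by
      have := (innerSL ℝ (Y ω)).hasFDerivAt (x := θ)
      refine this.congr_of_eventuallyEq (Eventually.of_forall fun θ => ?_)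
      simp [real_inner_comm]
    exact h1.exp

theorem gradient_log_integral_exp [IsProbabilityMeasure P] {Y : Ω → E d} (hY : AEMeasurable Y P)
    {U : Set (E d)} (hU : IsOpen U)
    (hint : ∀ θ ∈ U, Integrable (fun ω => Real.exp (inner ℝ θ (Y ω))) P)
    {θ₀ : E d} (hθ : θ₀ ∈ U) :
    gradient (fun θ => Real.log (∫ ω, Real.exp (inner ℝ θ (Y ω)) ∂P)) θ₀
      = (∫ ω, Real.exp (inner ℝ θ₀ (Y ω)) ∂P)⁻¹ • ∫ ω, Real.exp (inner ℝ θ₀ (Y ω)) • Y ω ∂P := by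
  have h1 := (hasGradientAt_integral_exp hY hU hint hθ).hasFDerivAt
  have h2 := h1.log (integral_exp_pos (hint θ₀ hθ)).ne'
  refine HasGradientAt.gradient ?_
  rw [hasGradientAt_iff_hasFDerivAt, map_smul]
  exact h2

/-- Continuous convergence of the logarithmic moment generating functions and of their gradients,
for random vectors that converge almost surely and whose moment generating functions converge
pointwise. -/
theorem tendsto_log_integral_exp_and_gradient [IsProbabilityMeasure P] {Y : ℕ → Ω → E d}
    {Y' : Ω → E d}
    (hY : ∀ j, AEMeasurable (Y j) P) (hY' : AEMeasurable Y' P)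
    (hlim : ∀ᵐ ω ∂P, Tendsto (fun j => Y j ω) atTop (𝓝 (Y' ω))) {U : Set (E d)} (hU : IsOpen U)
    (hint : ∀ j, ∀ θ ∈ U, Integrable (fun ω => Real.exp (inner ℝ θ (Y j ω))) P)
    (hint' : ∀ θ ∈ U, Integrable (fun ω => Real.exp (inner ℝ θ (Y' ω))) P)
    (hconv : ∀ θ ∈ U, Tendsto (fun j => ∫ ω, Real.exp (inner ℝ θ (Y j ω)) ∂P) atTop
      (𝓝 (∫ ω, Real.exp (inner ℝ θ (Y' ω)) ∂P)))
    {θ : ℕ → E d} {θ' : E d} (hθU : ∀ j, θ j ∈ U) (hθU' : θ' ∈ U)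
    (hθ : Tendsto θ atTop (𝓝 θ')) :
    Tendsto (fun j => Real.log (∫ ω, Real.exp (inner ℝ (θ j) (Y j ω)) ∂P)) atTop
      (𝓝 (Real.log (∫ ω, Real.exp (inner ℝ θ' (Y' ω)) ∂P))) ∧
    Tendsto (fun j => gradient (fun t => Real.log (∫ ω, Real.exp (inner ℝ t (Y j ω)) ∂P)) (θ j))
      atTop (𝓝 (gradient (fun t => Real.log (∫ ω, Real.exp (inner ℝ t (Y' ω)) ∂P)) θ')) := by
  obtain ⟨r, hr, C, p, hp, hb⟩ := exists_exp_inner_bound hU hθU'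
  -- a common shift puts all terms of the sequence into the ball
  obtain ⟨N, hN⟩ := eventually_atTop.1 (hθ.eventually (Metric.ball_mem_nhds θ' hr))
  have hmeas : ∀ (θ : E d) (Z : Ω → E d), AEMeasurable Z P →
      AEStronglyMeasurable (fun ω => Real.exp (inner ℝ θ (Z ω))) P := fun θ Z hZ =>
    (Real.measurable_exp.comp_aemeasurable (aemeasurable_const.inner hZ)).aestronglyMeasurable
  set G : (Ω → E d) → Ω → ℝ := fun Z ω => C * ∑ k, Real.exp (inner ℝ (p k) (Z ω)) with hG
  have hGi : ∀ j, Integrable (G (Y j)) P := fun j =>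
    (integrable_finsetSum _ fun k _ => hint j _ (hp k)).const_mul _
  have hGi' : Integrable (G Y') P :=
    (integrable_finsetSum _ fun k _ => hint' _ (hp k)).const_mul _
  have hGlim : ∀ᵐ ω ∂P, Tendsto (fun j => G (Y (j + N)) ω) atTop (𝓝 (G Y' ω)) := by
    filter_upwards [hlim] with ω hω
    have hω' := (tendsto_add_atTop_iff_nat N).2 hω
    exact (tendsto_finsetSum _ fun k _ => (Real.continuous_exp.tendsto _).comp
      (tendsto_const_nhds.inner hω')).const_mul C
  have hGint : Tendsto (fun j => ∫ ω, G (Y (j + N)) ω ∂P) atTop (𝓝 (∫ ω, G Y' ω ∂P)) := by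
    simp only [hG]
    simp_rw [integral_const_mul]
    rw [integral_finsetSum _ fun k _ => hint' _ (hp k)]
    simp_rw [fun j => integral_finsetSum (μ := P) Finset.univ fun k _ => hint (j + N) _ (hp k)]
    exact (tendsto_finsetSum _ fun k _ =>
      (tendsto_add_atTop_iff_nat N).2 (hconv _ (hp k))).const_mul C
  have hlimN : ∀ᵐ ω ∂P, Tendsto (fun j => Real.exp (inner ℝ (θ (j + N)) (Y (j + N) ω))) atTop
      (𝓝 (Real.exp (inner ℝ θ' (Y' ω)))) := by
    filter_upwards [hlim] with ω hω
    exact (Real.continuous_exp.tendsto _).comp (((tendsto_add_atTop_iff_nat N).2 hθ).inner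
      ((tendsto_add_atTop_iff_nat N).2 hω))
  have hball : ∀ j, θ (j + N) ∈ Metric.ball θ' r := fun j => hN _ (Nat.le_add_left N j)
  have h1 : Tendsto (fun j => ∫ ω, Real.exp (inner ℝ (θ j) (Y j ω)) ∂P) atTop
      (𝓝 (∫ ω, Real.exp (inner ℝ θ' (Y' ω)) ∂P)) := by
    rw [← tendsto_add_atTop_iff_nat N]
    refine tendsto_integral_of_tendsto_integral_bound (G := fun j => G (Y (j + N)))
      (fun j => hmeas _ _ (hY _)) (fun j => Eventually.of_forall fun ω => ?_) hlimN hGlim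
      (fun j => hGi _) hGi' hGint
    rw [Real.norm_of_nonneg (Real.exp_pos _).le]
    refine le_trans ?_ (hb _ (hball j) (Y (j + N) ω))
    exact le_mul_of_one_le_right (Real.exp_pos _).le (by linarith [norm_nonneg (Y (j + N) ω)])
  have h2 : Tendsto (fun j => ∫ ω, Real.exp (inner ℝ (θ j) (Y j ω)) • Y j ω ∂P) atTop
      (𝓝 (∫ ω, Real.exp (inner ℝ θ' (Y' ω)) • Y' ω ∂P)) := by
    rw [← tendsto_add_atTop_iff_nat N]
    refine tendsto_integral_of_tendsto_integral_bound (G := fun j => G (Y (j + N)))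
      (fun j => (hmeas _ _ (hY _)).smul (hY _).aestronglyMeasurable)
      (fun j => Eventually.of_forall fun ω => ?_) ?_ hGlim (fun j => hGi _) hGi' hGint
    · rw [norm_smul, Real.norm_of_nonneg (Real.exp_pos _).le]
      refine le_trans ?_ (hb _ (hball j) (Y (j + N) ω))
      gcongr
      linarith
    · filter_upwards [hlimN, hlim] with ω hω hω2
      exact hω.smul ((tendsto_add_atTop_iff_nat N).2 hω2)
  have hpos := (integral_exp_pos (hint' θ' hθU')).ne'
  refine ⟨h1.log hpos, ?_⟩
  rw [gradient_log_integral_exp hY' hU hint' hθU']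
  simp_rw [fun j => gradient_log_integral_exp (hY j) hU (hint j) (hθU j)]
  exact (h1.inv₀ hpos).smul h2

end Cumulant

namespace IsPureJumpLevy

variable {d : ℕ} {Ω : Type*} [MeasurableSpace Ω] {P : Measure Ω} [IsProbabilityMeasure P]
  {b : E d} {ν : Measure (E d)} {L : ℝ≥0 → Ω → E d}

/-- The remainder is centred and independent of the truncation, so that by `1 + x ≤ exp x` it can
only increase exponential moments. -/
theorem lintegral_exp_truncated_le (hL : IsPureJumpLevy P b ν L) (hν : IsLevyMeasure ν) (T : ℝ≥0)
    (θ : E d) {ε : ℝ} (hε : 0 < ε) (hε1 : ε ≤ 1) :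
    ∫⁻ ω, ENNReal.ofReal (Real.exp (inner ℝ θ (truncated b ν L ε T ω))) ∂P
      ≤ ∫⁻ ω, ENNReal.ofReal (Real.exp (inner ℝ θ (L T ω))) ∂P := by
  have hm := hL.aemeasurable_truncated hε hε1 T
  have hmR := (hL.measurable T).aemeasurable.sub hm
  obtain ⟨hRi, hR0, -⟩ := hL.moments_inner_sub_truncated hν T θ hε hε1
  set f : ℝ → ℝ≥0∞ := fun y => ENNReal.ofReal (Real.exp y) with hf
  have hfm : Measurable f := by fun_prop
  have hR1 : 1 ≤ ∫⁻ ω, f (inner ℝ θ (L T ω - truncated b ν L ε T ω)) ∂P := by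
    have h1 : Integrable (fun ω => (inner ℝ θ (L T ω - truncated b ν L ε T ω) : ℝ) + 1) P :=
      hRi.add (integrable_const 1)
    calc (1 : ℝ≥0∞) = ENNReal.ofReal
          (∫ ω, ((inner ℝ θ (L T ω - truncated b ν L ε T ω) : ℝ) + 1) ∂P) := by
          rw [integral_add hRi (integrable_const 1), hR0]; simp
      _ ≤ ∫⁻ ω, ENNReal.ofReal ((inner ℝ θ (L T ω - truncated b ν L ε T ω) : ℝ) + 1) ∂P :=
          ofReal_integral_le_lintegral_ofReal h1
      _ ≤ _ := lintegral_mono fun ω => ENNReal.ofReal_le_ofReal (Real.add_one_le_exp _)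
  have hprod := lintegral_mul_eq_lintegral_mul_lintegral_of_indepFun''
    (hfm.comp_aemeasurable (aemeasurable_const.inner hm))
    (hfm.comp_aemeasurable (aemeasurable_const.inner hmR))
    ((hL.indepFun_inner_truncated hν T θ hε hε1).comp hfm hfm)
  have e : ∀ ω, f (inner ℝ θ (L T ω)) = f (inner ℝ θ (truncated b ν L ε T ω))
      * f (inner ℝ θ (L T ω - truncated b ν L ε T ω)) := fun ω => by
    rw [hf]
    simp only
    rw [← ENNReal.ofReal_mul (Real.exp_pos _).le, ← Real.exp_add, ← inner_add_right,
      add_sub_cancel]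
  change _ ≤ ∫⁻ ω, f (inner ℝ θ (L T ω)) ∂P
  simp_rw [e]
  refine le_trans ?_ hprod.ge
  exact le_mul_of_one_le_right' hR1

theorem integrable_exp_truncated (hL : IsPureJumpLevy P b ν L) (hν : IsLevyMeasure ν) (T : ℝ≥0)
    {θ : E d} (hθ : Integrable (fun ω => Real.exp (inner ℝ θ (L T ω))) P)
    {ε : ℝ} (hε : 0 < ε) (hε1 : ε ≤ 1) :
    Integrable (fun ω => Real.exp (inner ℝ θ (truncated b ν L ε T ω))) P := by
  refine ⟨(Real.measurable_exp.comp_aemeasurable (aemeasurable_const.inner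
    (hL.aemeasurable_truncated hε hε1 T))).aestronglyMeasurable, ?_⟩
  rw [hasFiniteIntegral_iff_ofReal (Eventually.of_forall fun ω => (Real.exp_pos _).le)]
  refine (hL.lintegral_exp_truncated_le hν T θ hε hε1).trans_lt ?_
  exact (hasFiniteIntegral_iff_ofReal (Eventually.of_forall fun ω => (Real.exp_pos _).le)).1 hθ.2

/-- The exponential moments of the truncations converge: they are at most those of `L_T`, and
Fatou's lemma gives the other bound. -/
theorem tendsto_integral_exp_truncated (hL : IsPureJumpLevy P b ν L) (hν : IsLevyMeasure ν)
    (T : ℝ≥0) {θ : E d} (hθ : Integrable (fun ω => Real.exp (inner ℝ θ (L T ω))) P)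
    {ε : ℕ → ℝ} (hε : ∀ j, 0 < ε j) (hε1 : ∀ j, ε j ≤ 1) (hlim : Tendsto ε atTop (𝓝[>] 0)) :
    Tendsto (fun j => ∫ ω, Real.exp (inner ℝ θ (truncated b ν L (ε j) T ω)) ∂P) atTop
      (𝓝 (∫ ω, Real.exp (inner ℝ θ (L T ω)) ∂P)) := by
  have hfin : ∫⁻ ω, ENNReal.ofReal (Real.exp (inner ℝ θ (L T ω))) ∂P ≠ ∞ :=
    ((hasFiniteIntegral_iff_ofReal (Eventually.of_forall fun ω => (Real.exp_pos _).le)).1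
      hθ.2).ne
  have hmeas : ∀ j, AEMeasurable
      (fun ω => Real.exp (inner ℝ θ (truncated b ν L (ε j) T ω))) P := fun j =>
    Real.measurable_exp.comp_aemeasurable (aemeasurable_const.inner
      (hL.aemeasurable_truncated (hε j) (hε1 j) T))
  have hfatou : ∫⁻ ω, ENNReal.ofReal (Real.exp (inner ℝ θ (L T ω))) ∂P
      ≤ liminf (fun j => ∫⁻ ω, ENNReal.ofReal
        (Real.exp (inner ℝ θ (truncated b ν L (ε j) T ω))) ∂P) atTop := by
    refine le_trans (lintegral_mono_ae ?_) (lintegral_liminf_le' (u := atTop)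
      fun j => (hmeas j).ennreal_ofReal)
    filter_upwards [hL.ae_tendsto_truncated hν T] with ω hω
    have h1 := (tendsto_const_nhds (x := θ)).inner (hω.comp hlim) (𝕜 := ℝ)
    exact (((ENNReal.continuous_ofReal.comp Real.continuous_exp).tendsto _).comp
      h1).liminf_eq.ge
  have hub : ∀ j, ∫⁻ ω, ENNReal.ofReal (Real.exp (inner ℝ θ (truncated b ν L (ε j) T ω))) ∂P
      ≤ ∫⁻ ω, ENNReal.ofReal (Real.exp (inner ℝ θ (L T ω))) ∂P := fun j =>
    hL.lintegral_exp_truncated_le hν T θ (hε j) (hε1 j)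
  have hlimsup := limsup_le_of_le (u := fun j => ∫⁻ ω, ENNReal.ofReal
    (Real.exp (inner ℝ θ (truncated b ν L (ε j) T ω))) ∂P) (f := atTop) (by isBoundedDefault)
    (Eventually.of_forall hub)
  have key := tendsto_of_le_liminf_of_limsup_le hfatou hlimsup
  rw [integral_eq_lintegral_of_nonneg_ae (Eventually.of_forall fun ω => (Real.exp_pos _).le) hθ.1]
  simp_rw [fun j => integral_eq_lintegral_of_nonneg_ae (μ := P)
    (Eventually.of_forall fun ω => (Real.exp_pos _).le) (hmeas j).aestronglyMeasurable]
  exact (ENNReal.tendsto_toReal hfin).comp key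

end IsPureJumpLevy

/-! ### Projection and recursion -/

section Projection

variable {d : ℕ} {K : Set (E d)}

theorem proj_spec (hK : IsCompact K) (hne : K.Nonempty) (x : E d) :
    proj K x ∈ K ∧ ∀ z ∈ K, ‖x - proj K x‖ ≤ ‖x - z‖ := by
  refine Classical.epsilon_spec (p := fun y => y ∈ K ∧ ∀ z ∈ K, ‖x - y‖ ≤ ‖x - z‖) ?_
  obtain ⟨y, hy, hmin⟩ := hK.exists_isMinOn hne
    (f := fun y => ‖x - y‖) (by fun_prop)
  exact ⟨y, hy, fun z hz => hmin hz⟩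

/-- The variational characterization of the projection onto a convex set. -/
theorem inner_sub_proj_le_zero (hK : IsCompact K) (hconv : Convex ℝ K) (hne : K.Nonempty)
    (x : E d) : ∀ w ∈ K, (inner ℝ (x - proj K x) (w - proj K x) : ℝ) ≤ 0 := by
  obtain ⟨h1, h2⟩ := proj_spec hK hne x
  refine (norm_eq_iInf_iff_real_inner_le_zero hconv h1).1 ?_
  have : Nonempty K := hne.to_subtype
  refine le_antisymm (le_ciInf fun w => h2 w w.2) ?_
  exact ciInf_le ⟨0, by rintro _ ⟨w, rfl⟩; exact norm_nonneg _⟩ (⟨_, h1⟩ : K)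

theorem continuous_proj (hK : IsCompact K) (hconv : Convex ℝ K) (hne : K.Nonempty) :
    Continuous (proj K) := by
  refine (LipschitzWith.of_dist_le_mul (K := 1) fun x y => ?_).continuous
  rw [dist_eq_norm, dist_eq_norm, NNReal.coe_one, one_mul]
  have h1 := inner_sub_proj_le_zero hK hconv hne x _ (proj_spec hK hne y).1
  have h2 := inner_sub_proj_le_zero hK hconv hne y _ (proj_spec hK hne x).1
  set p := proj K x
  set q := proj K y
  have e : (inner ℝ (x - y) (p - q) : ℝ) = ‖p - q‖ ^ 2
      - inner ℝ (x - p) (q - p) - inner ℝ (y - q) (p - q) := by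
    rw [← real_inner_self_eq_norm_sq]
    simp only [inner_sub_left, inner_sub_right]
    ring
  have h3 := real_inner_le_norm (x - y) (p - q)
  have h4 : ‖p - q‖ * ‖p - q‖ ≤ ‖x - y‖ * ‖p - q‖ := by nlinarith
  rcases (norm_nonneg (p - q)).eq_or_lt with h0 | h0
  · rw [← h0]; exact norm_nonneg _
  · exact le_of_mul_le_mul_right h4 h0

theorem iterate_mem (hK : IsCompact K) {H : E d → E d → E d} {gain : ℕ → ℝ} {θ₀ : E d}
    (hθ₀ : θ₀ ∈ K) (x : ℕ → E d) : ∀ n, iterate K H gain θ₀ x n ∈ K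
  | 0 => hθ₀
  | _ + 1 => (proj_spec hK ⟨θ₀, hθ₀⟩ _).1

/-- The recursion depends continuously on its data, if the fields converge continuously. -/
theorem tendsto_iterate (hK : IsCompact K) (hconv : Convex ℝ K) {H : ℕ → E d → E d → E d}
    {H' : E d → E d → E d} (gain : ℕ → ℝ) {θ₀ : E d} (hθ₀ : θ₀ ∈ K) {x : ℕ → ℕ → E d}
    {x' : ℕ → E d} (hx : ∀ k, Tendsto (fun j => x j k) atTop (𝓝 (x' k)))
    (hH : ∀ (θ : ℕ → E d) (θ' : E d) (y : ℕ → E d) (y' : E d), (∀ j, θ j ∈ K) → θ' ∈ K →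
      Tendsto θ atTop (𝓝 θ') → Tendsto y atTop (𝓝 y') →
      Tendsto (fun j => H j (θ j) (y j)) atTop (𝓝 (H' θ' y'))) (n : ℕ) :
    Tendsto (fun j => iterate K (H j) gain θ₀ (x j) n) atTop
      (𝓝 (iterate K H' gain θ₀ x' n)) := by
  induction n with
  | zero => exact tendsto_const_nhds
  | succ n ih =>
    exact ((continuous_proj hK hconv ⟨θ₀, hθ₀⟩).tendsto _).comp
      (ih.sub ((hH _ _ _ _ (fun j => iterate_mem hK hθ₀ _ n) (iterate_mem hK hθ₀ _ n) ih
        (hx n)).const_smul (gain n)))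

end Projection

theorem continuous_weight {d : ℕ} (i : Fin 2) {F : E d → ℝ} (S : Matrix (Fin d) (Fin d) ℝ)
    (hF₁ : i = 0 → Continuous F) (hF₂ : i = 1 → ContDiff ℝ 1 F) : Continuous (weight F S i) := by
  fin_cases i
  · exact (hF₁ rfl).pow 2
  · have hgrad : Continuous (gradient F) :=
      (InnerProductSpace.toDual ℝ (E d)).symm.continuous.comp
        ((hF₂ rfl).continuous_fderiv one_ne_zero)
    exact hgrad.inner ((LinearMap.continuous_of_finiteDimensional _).comp hgrad)

theorem tendsto_gradField {d : ℕ} (T : ℝ≥0) {κ : ℕ → E d → ℝ} {κ' f : E d → ℝ} (hf : Continuous f)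
    {θ y : ℕ → E d} {θ' y' : E d} (hθ : Tendsto θ atTop (𝓝 θ')) (hy : Tendsto y atTop (𝓝 y'))
    (hκ : Tendsto (fun j => κ j (θ j)) atTop (𝓝 (κ' θ')))
    (hκ' : Tendsto (fun j => gradient (κ j) (θ j)) atTop (𝓝 (gradient κ' θ'))) :
    Tendsto (fun j => gradField T (κ j) f (θ j) (y j)) atTop (𝓝 (gradField T κ' f θ' y')) := by
  unfold gradField
  refine Tendsto.smul (Tendsto.mul ((hf.tendsto _).comp hy)
    ((Real.continuous_exp.tendsto _).comp ?_)) ((hκ'.const_smul _).sub hy)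
  exact (hθ.inner hy).neg.add (hκ.const_mul _)

/-- Limits as `ε` decreases to `0` may be computed along sequences in `(0, 1]`. -/
theorem tendsto_nhdsGT_zero_of_seq {β : Type*} {f : ℝ → β} {l : Filter β}
    (h : ∀ ε : ℕ → ℝ, (∀ j, 0 < ε j) → (∀ j, ε j ≤ 1) → Tendsto ε atTop (𝓝[>] 0) →
      Tendsto (fun j => f (ε j)) atTop l) : Tendsto f (𝓝[>] 0) l := by
  refine tendsto_of_seq_tendsto fun ε hε => ?_
  obtain ⟨N, hN⟩ := eventually_atTop.1 (hε.eventually (Ioc_mem_nhdsGT (zero_lt_one' ℝ)))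
  refine (tendsto_add_atTop_iff_nat N).1 ?_
  exact h (fun j => ε (j + N)) (fun j => (hN _ (Nat.le_add_left N j)).1)
    (fun j => (hN _ (Nat.le_add_left N j)).2) ((tendsto_add_atTop_iff_nat N).2 hε)

end LevySA

end

theorem theorem5p2 {d : ℕ} {Ω : Type*} [MeasurableSpace Ω] (P : Measure Ω)
    [IsProbabilityMeasure P]
    -- the Lévy process `L` with triplet `(b, 0, ν)`, and the time horizon `T > 0`
    (b : LevySA.E d) (ν : Measure (LevySA.E d)) (hν : LevySA.IsLevyMeasure ν)
    (L : ℝ≥0 → Ω → LevySA.E d) (hL : LevySA.IsPureJumpLevy P b ν L)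
    (T : ℝ≥0) (hT : 0 < T)
    -- the independent copies of the process; `X n` is the copy with number `n + 1`
    (X : ℕ → ℝ≥0 → Ω → LevySA.E d) (hX : ∀ n, LevySA.IsPureJumpLevy P b ν (X n))
    (hX_indep : iIndepFun (fun (n : ℕ) (ω : Ω) (t : ℝ≥0) => X n t ω) P)
    -- the index of the criterion and the functions `F₁ = F²`, `F₂ = ∇F · S ∇F`
    (i : Fin 2) (F : LevySA.E d → ℝ) (S : Matrix (Fin d) (Fin d) ℝ)
    (hF₁ : i = 0 → Continuous F) (hF₂ : i = 1 → ContDiff ℝ 1 F)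
    -- the constraint set
    (K : Set (LevySA.E d)) (hK_compact : IsCompact K) (hK_convex : Convex ℝ K)
    (hK_zero : (0 : LevySA.E d) ∈ K) (hK : K ⊆ interior (LevySA.expMomentSet P L))
    -- the gain sequence; `gain n` is the gain with number `n + 1`
    (gain : ℕ → ℝ) (h_pos : ∀ n, 0 < gain n) (h_anti : Antitone gain)
    (h_sum : ¬ Summable gain) (h_sq : Summable fun n => gain n ^ 2)
    (θ₀ : LevySA.E d) (hθ₀ : θ₀ ∈ K) (n : ℕ) :
    -- the same function `H`, built with the cumulant function of `L`, in both recursions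
    (∀ᵐ ω ∂P, Tendsto
      (fun ε : ℝ => LevySA.iterate K
        (LevySA.gradField T (LevySA.cumulant P L) (LevySA.weight F S i)) gain θ₀
        (fun k => LevySA.truncated b ν (X k) ε T ω) n)
      (𝓝[>] 0)
      (𝓝 (LevySA.iterate K
        (LevySA.gradField T (LevySA.cumulant P L) (LevySA.weight F S i)) gain θ₀
        (fun k => X k T ω) n))) ∧
    -- the recursion for `ε` built with the cumulant function of the truncated process
    (∀ᵐ ω ∂P, Tendsto
      (fun ε : ℝ => LevySA.iterate K
        (LevySA.gradField T (LevySA.cumulant P (LevySA.truncated b ν L ε))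
          (LevySA.weight F S i)) gain θ₀
        (fun k => LevySA.truncated b ν (X k) ε T ω) n)
      (𝓝[>] 0)
      (𝓝 (LevySA.iterate K
        (LevySA.gradField T (LevySA.cumulant P L) (LevySA.weight F S i)) gain θ₀
        (fun k => X k T ω) n))) := by
  have hall : ∀ᵐ ω ∂P, ∀ k, Tendsto (fun ε => LevySA.truncated b ν (X k) ε T ω) (𝓝[>] 0)
      (𝓝 (X k T ω)) := ae_all_iff.2 fun k => (hX k).ae_tendsto_truncated hν T
  have hf := LevySA.continuous_weight i S hF₁ hF₂
  set U := interior (LevySA.expMomentSet P L) with hU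
  have hUint : ∀ θ ∈ U, Integrable (fun ω => Real.exp (inner ℝ θ (L 1 ω))) P := fun θ hθ =>
    (interior_subset hθ : θ ∈ LevySA.expMomentSet P L)
  have hL1 := (hL.measurable 1).aemeasurable (μ := P)
  constructor
  · filter_upwards [hall] with ω hω
    refine LevySA.tendsto_nhdsGT_zero_of_seq fun ε hε hε1 hlim => ?_
    refine LevySA.tendsto_iterate hK_compact hK_convex gain hθ₀ (fun k => (hω k).comp hlim)
      (fun θ θ' y y' hθK hθK' hθ hy => ?_) n
    obtain ⟨h1, h2⟩ := LevySA.tendsto_log_integral_exp_and_gradient (Y := fun _ => L 1)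
      (fun _ => hL1) hL1 (Eventually.of_forall fun _ => tendsto_const_nhds) isOpen_interior
      (fun _ => hUint) hUint (fun _ _ => tendsto_const_nhds) (fun j => hK (hθK j)) (hK hθK') hθ
    exact LevySA.tendsto_gradField T hf hθ hy h1 h2
  · filter_upwards [hall] with ω hω
    refine LevySA.tendsto_nhdsGT_zero_of_seq fun ε hε hε1 hlim => ?_
    refine LevySA.tendsto_iterate hK_compact hK_convex gain hθ₀ (fun k => (hω k).comp hlim)
      (fun θ θ' y y' hθK hθK' hθ hy => ?_) n
    obtain ⟨h1, h2⟩ := LevySA.tendsto_log_integral_exp_and_gradient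
      (Y := fun j => LevySA.truncated b ν L (ε j) 1)
      (fun j => hL.aemeasurable_truncated (hε j) (hε1 j) 1) hL1
      (by
        filter_upwards [hL.ae_tendsto_truncated hν 1] with ω' hω'
        exact hω'.comp hlim)
      isOpen_interior
      (fun j θ hθ => hL.integrable_exp_truncated hν 1 (hUint θ hθ) (hε j) (hε1 j)) hUint
      (fun θ hθ => hL.tendsto_integral_exp_truncated hν 1 (hUint θ hθ) hε hε1 hlim)
      (fun j => hK (hθK j)) (hK hθK') hθ
    exact LevySA.tendsto_gradField T hf hθ hy h1 h2
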